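/- **Setting.** Let $\mathcal S,\mathcal A$ be finite nonempty sets, $\mathcal P(\cdot\mid s,a)$ a transition kernel, $\rho$ an initial distribution on $\mathcal S$ and $\gamma\in(0,1)$. For a policy $\pi$ let $\lambda^\pi(s,a)=d^\pi(s)\pi(a|s)$ with $d^\pi(s)=(1-\gamma)\sum_{t\ge0}\gamma^t\,\mathbb P_{\rho,\pi}(s_t=s)$. Consider softmax policies $\pi_\theta(a|s)\propto\exp\psi(s,a;\theta)$, $\theta\in\mathbb R^d$, where every $\psi(s,a;\cdot)$ is $C^2$ with $\|\nabla\psi\|\le l_\psi$ and $\|\nabla^2\psi\|\le L_\psi$; put $\lambda(\theta)=\lambda^{\pi_\theta}$. Let $\Lambda\subset\mathbb R^{\mathcal S\times\mathcal A}$ be a convex set that contains all $\lambda(\theta)$ and all the estimates $p_\omega\cdot\pi_\theta$, $(p_\omega\cdot\pi_\theta)(s,a)=p_\omega(s)\pi_\theta(a|s)$, where $\{p_\omega:\omega\in W\}$, $W\subset\mathbb R^m$, is a class of distributions on $\mathcal S$. The utility $F$ is concave on $\Lambda$ and differentiable at the points of $\Lambda$, and there $\|\nabla F\|_2\le l_\lambda$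 and $\nabla F$ is $L_\lambda$-Lipschitz (all these constants are positive). **Overparametrization on a set $\Theta\subset\mathbb R^d$.** The maximum $F^\star=\max_{\theta\in\Theta}F(\lambda(\theta))$ is attained at some $\theta^*\in\Theta$, and for every $\theta\in\Theta$ there are sets $U_\theta\ni\theta$ and $\Lambda\supset V_\theta\ni\lambda(\theta)$ such that (i) $\lambda|_{U_\theta}:U_\theta\to V_\theta$ is a bijection; (ii) its inverse is $l$-Lipschitz, with $l>0$ independent of $\theta$; (iii) $(1-\eta)\lambda(\theta)+\eta\lambda(\theta^*)\in V_\theta$ for all $0<\eta\le\bar\eta$, with $\bar\eta>0$ independent of $\theta$. **Algorithm.** Start from a (possibly random) $\theta_0$. At iteration $t<T$: draw $n$ states that, given the past, are i.i.d. with law $d^{\pi_{\theta_t}}$; let $\omega_t$ maximize the average log-likelihood of these states over $W$, and let $\hat\lambda_t=p_{\omega_t}\cdot\pi_{\theta_t}$; draw $N\ge1$ trajectories $\tau_t^{(i)}$ that, given all of this, are i.i.d. with the law of the first $H$ state-action pairs under $\pi_{\theta_t}$; set $\theta_{t+1}=\theta_t+\frac{\alpha}{N}\sum_{i=1}^N g(\tau_t^{(i)},\theta_t,\nabla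 F(\hat\lambda_t))$, where $g(\tau,\theta,r)=\sum_{t=0}^{H-1}\big(\sum_{h=t}^{H-1}\gamma^h r(s_h,a_h)\big)\nabla\log\pi_\theta(a_t|s_t)$. The step size satisfies $0<\alpha\le 1/(2L_\theta)$ with $L_\theta=\frac{4L_\lambda l_\psi^2}{(1-\gamma)^4}+\frac{8l_\psi^2l_\lambda}{(1-\gamma)^3}+\frac{2l_\lambda(L_\psi+l_\psi^2)}{(1-\gamma)^2}$. **Theorem.** Assume overparametrization on $\Theta$, that $\theta_0,\dots,\theta_{T-1}\in\Theta$ almost surely, and that $\mathbb E\|\hat\lambda_t-\lambda(\theta_t)\|_2^2\le\epsilon_{\rm MLE}$ for all $t<T$, where $\epsilon_{\rm MLE}>0$. Let $0<\eta<\bar\eta$, $\eta\le1$, $\delta_0=\mathbb E[F^\star-F(\lambda(\theta_0))]$, $C_3=\frac{4l^2}{(1-\gamma)^2}\big(16+\tfrac{\alpha L_\theta}{2}\big)\ \big(\le\frac{65\,l^2}{(1-\gamma)^2}\big)$ and $C_4=\frac{5\,l_\psi^2\max(l_\lambda^2,L_\lambda^2)}{(1-\gamma)^4}$. Then the random variables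 $F(\lambda(\theta_t))$, $t\le T$, are integrable, and: (a) if $\Theta=\mathbb R^d$, then $$\mathbb E[F^\star-F(\lambda(\theta_T))]\le(1-\eta)^T\delta_0+C_3\frac{\eta}{\alpha}+C_4\frac{\alpha}{\eta}\Big(\frac1N+\epsilon_{\rm MLE}\Big);$$ (b) for every $\Theta$, $$\mathbb E[F^\star-F(\lambda(\theta_T))]\le(1-\eta)^T\delta_0+C_3\frac{\eta}{\alpha}+C_4\frac{\alpha}{\eta}\Big(\frac1N+\epsilon_{\rm MLE}+(H+1)^2\gamma^{2H}\Big).$$ -/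

import Mathlib

open MeasureTheory
open scoped NNReal

noncomputable section

namespace RLGU

/-- A finite discounted Markov decision process without its utility: transition kernel `P`,
initial state distribution `ρ`, discount factor `γ`. -/
structure MDP (S A : Type*) [Fintype S] where
  /-- `P s a s'` is the probability of moving to `s'` from `s` under the action `a`. -/
  P : S → A → S → ℝ
  P_mem : ∀ s a, P s a ∈ stdSimplex ℝ S
  /-- the initial state distribution -/
  ρ : S → ℝ
  ρ_mem : ρ ∈ stdSimplex ℝ S
  /-- the discount factor -/
  γ : ℝ
  γ_pos : 0 < γ
  γ_lt_one : γ < 1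

/-- The parameter space `ℝ^d` with its Euclidean norm. -/
abbrev Param (d : ℕ) : Type := EuclideanSpace ℝ (Fin d)

/-- State-action vectors, i.e. `ℝ^(|S||A|)` with its Euclidean norm. -/
abbrev SAVec (S A : Type*) : Type _ := EuclideanSpace ℝ (S × A)

variable {S A : Type*} [Fintype S] [Fintype A]

/-- The probability, under the chain with initial distribution `ρ` and policy `π`, that the first
`H` state-action pairs are `τ`: the product of `ρ(s₀)`, of the transition probabilities
`P(s_h | s_{h-1}, a_{h-1})` for `0 < h < H`, and of `π(a_h | s_h)` for `h < H`. -/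
def trajProb (M : MDP S A) (π : S → A → ℝ) {H : ℕ} (τ : Fin H → S × A) : ℝ :=
  ∏ h : Fin H,
    (if h.val = 0 then M.ρ (τ h).1
      else
        M.P (τ ⟨h.val - 1, lt_of_le_of_lt (Nat.sub_le _ _) h.isLt⟩).1
          (τ ⟨h.val - 1, lt_of_le_of_lt (Nat.sub_le _ _) h.isLt⟩).2 (τ h).1)
      * π (τ h).1 (τ h).2

open scoped Classical in
/-- `ℙ_{ρ,π}(s_t = s)`. -/
def stateProb (M : MDP S A) (π : S → A → ℝ) (t : ℕ) (s : S) : ℝ :=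
  ∑ τ : Fin (t + 1) → S × A, if (τ (Fin.last t)).1 = s then trajProb M π τ else 0

/-- The normalized state occupancy measure `d^π`. -/
def stateOcc (M : MDP S A) (π : S → A → ℝ) (s : S) : ℝ :=
  (1 - M.γ) * ∑' t : ℕ, M.γ ^ t * stateProb M π t s

/-- The state-action vector `(s,a) ↦ q(s) π(a|s)`. -/
def withPolicy (q : S → ℝ) (π : S → A → ℝ) : SAVec S A :=
  WithLp.toLp 2 fun x => q x.1 * π x.1 x.2

/-- The normalized state-action occupancy measure `λ^π(s,a) = d^π(s) π(a|s)`. -/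
def occ (M : MDP S A) (π : S → A → ℝ) : SAVec S A :=
  withPolicy (stateOcc M π) π

/-- The softmax policy `π_θ(a|s)` with preferences `ψ(s,a;θ)`. -/
def softmax {d : ℕ} (ψ : S → A → Param d → ℝ) (θ : Param d) (s : S) (a : A) : ℝ :=
  Real.exp (ψ s a θ) / ∑ a' : A, Real.exp (ψ s a' θ)

/-- `λ(θ) = λ^{π_θ}`. -/
def lam (M : MDP S A) {d : ℕ} (ψ : S → A → Param d → ℝ) (θ : Param d) : SAVec S A :=
  occ M (softmax ψ θ)

/-- The score function `∇_θ log π_θ(a|s)`. -/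
def score {d : ℕ} (ψ : S → A → Param d → ℝ) (θ : Param d) (s : S) (a : A) : Param d :=
  gradient (fun θ' => Real.log (softmax ψ θ' s a)) θ

/-- The truncated policy gradient estimate
`g(τ,θ,r) = ∑_{t<H} (∑_{t≤h<H} γ^h r(s_h,a_h)) ∇ log π_θ(a_t|s_t)`. -/
def gEst (M : MDP S A) {d : ℕ} (ψ : S → A → Param d → ℝ) {H : ℕ}
    (τ : Fin H → S × A) (θ : Param d) (r : SAVec S A) : Param d :=
  ∑ t : Fin H, (∑ h ∈ Finset.Ici t, M.γ ^ h.val * r (τ h)) • score ψ θ (τ t).1 (τ t).2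

/-- The preferences are twice continuously differentiable in `θ`, with gradients bounded by `lψ`
and Hessians bounded (in operator norm) by `Lψ`. -/
structure PolicyRegular {d : ℕ} (ψ : S → A → Param d → ℝ) (lψ Lψ : ℝ) : Prop where
  lψ_pos : 0 < lψ
  Lψ_pos : 0 < Lψ
  contDiff : ∀ s a, ContDiff ℝ 2 (ψ s a)
  grad_le : ∀ s a θ, ‖gradient (ψ s a) θ‖ ≤ lψ
  hess_le : ∀ s a θ, ‖fderiv ℝ (fderiv ℝ (ψ s a)) θ‖ ≤ Lψ

/-- Smoothness of the utility on `Λ`: bounded and Lipschitz gradient, in Euclidean norm. -/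
structure UtilitySmooth (F : SAVec S A → ℝ) (Λ : Set (SAVec S A)) (lF LF : ℝ) : Prop where
  lF_pos : 0 < lF
  LF_pos : 0 < LF
  differentiableAt : ∀ x ∈ Λ, DifferentiableAt ℝ F x
  grad_le : ∀ x ∈ Λ, ‖gradient F x‖ ≤ lF
  grad_lipschitz : ∀ x ∈ Λ, ∀ y ∈ Λ, ‖gradient F x - gradient F y‖ ≤ LF * ‖x - y‖

/-- Overparametrization on a set `Θ` of parameters (`Θ = ℝ^d` being the global assumption):
(i) around each `θ ∈ Θ` the map `λ` restricts to a bijection from a set `U θ` containing `θ` to a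
set `V θ ⊆ Λ` containing `λ(θ)`; (ii) the inverses of these bijections are Lipschitz with one
constant `l`; (iii) for `0 < η ≤ ηbar` the point `(1-η) λ(θ) + η λ(θstar)` lies in `V θ`.
Neither `U θ` nor `V θ` is required to be open, so that the case in which they are relative
neighbourhoods is included. -/
def Overparametrized (M : MDP S A) {d : ℕ} (ψ : S → A → Param d → ℝ) (Λ : Set (SAVec S A))
    (Θ : Set (Param d)) (θstar : Param d) (l : ℝ≥0) (ηbar : ℝ) : Prop :=
  ∃ (U : Param d → Set (Param d)) (V : Param d → Set (SAVec S A)),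
    (∀ θ ∈ Θ, θ ∈ U θ ∧ lam M ψ θ ∈ V θ ∧ V θ ⊆ Λ ∧ Set.BijOn (lam M ψ) (U θ) (V θ)) ∧
    (∀ θ ∈ Θ, LipschitzOnWith l (Function.invFunOn (lam M ψ) (U θ)) (V θ)) ∧
    (∀ θ ∈ Θ, ∀ η : ℝ, 0 < η → η ≤ ηbar →
      (1 - η) • lam M ψ θ + η • lam M ψ θstar ∈ V θ)

/-- The average log-likelihood of the sample `y` under `q`, with `log 0 = -∞`. -/
def avgLogLik {n : ℕ} (q : S → ℝ) (y : Fin n → S) : EReal :=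
  ((1 / (n : ℝ) : ℝ) : EReal) * ∑ j : Fin n, ENNReal.log (ENNReal.ofReal (q (y j)))

open scoped Classical in
/-- A run of `T` iterations of policy gradient for general utilities with occupancy measure
approximation, on a probability space `(Ω, μ)`: batches of `N` trajectories of length `H`, step size
`α`, maximum likelihood over `{p w | w ∈ W}` from `n` state samples. The σ-algebra `past t`
represents the information before iteration `t`, and `mid t` the information after the occupancy
estimation of iteration `t` and before the trajectories of iteration `t` are drawn. -/
structure Run (M : MDP S A) {d : ℕ} (ψ : S → A → Param d → ℝ) (F : SAVec S A → ℝ)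
    {m : ℕ} (W : Set (Fin m → ℝ)) (p : (Fin m → ℝ) → S → ℝ)
    {Ω : Type*} [mΩ : MeasurableSpace Ω] (μ : Measure Ω) (T N H n : ℕ) (α : ℝ) where
  past : ℕ → MeasurableSpace Ω
  mid : ℕ → MeasurableSpace Ω
  past_le_mid : ∀ t, past t ≤ mid t
  mid_le_past : ∀ t, mid t ≤ past (t + 1)
  past_le : ∀ t, past t ≤ mΩ
  /-- the iterates; `θ 0` is the (possibly random) initial parameter -/
  θ : ℕ → Ω → Param d
  measurable_θ : ∀ t ≤ T, Measurable[past t] (θ t)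
  /-- the state samples used for the occupancy estimation -/
  samples : ℕ → Ω → Fin n → S
  measurable_samples : ∀ t < T, ∀ y, MeasurableSet[mid t] {ω | samples t ω = y}
  /-- given the past, the samples are i.i.d. with law `d^{π_{θ_t}}` -/
  samples_law : ∀ t < T, ∀ y,
    μ[Set.indicator {ω | samples t ω = y} (fun _ => (1 : ℝ)) | past t]
      =ᵐ[μ] fun ω => ∏ j, stateOcc M (softmax ψ (θ t ω)) (y j)
  /-- the maximum likelihood parameter -/
  w : ℕ → Ω → Fin m → ℝ
  w_mem : ∀ t < T, ∀ ω, w t ω ∈ W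
  w_max : ∀ t < T, ∀ ω, IsMaxOn (fun v => avgLogLik (p v) (samples t ω)) W (w t ω)
  measurable_estimate : ∀ t < T,
    Measurable[mid t] fun ω => withPolicy (p (w t ω)) (softmax ψ (θ t ω))
  /-- the batch of trajectories -/
  traj : ℕ → Ω → Fin N → Fin H → S × A
  measurable_traj : ∀ t < T, ∀ x, MeasurableSet[past (t + 1)] {ω | traj t ω = x}
  /-- given the information before they are drawn, the trajectories of iteration `t` are i.i.d.
  with the law of the first `H` state-action pairs under `π_{θ_t}` -/
  traj_law : ∀ t < T, ∀ x,
    μ[Set.indicator {ω | traj t ω = x} (fun _ => (1 : ℝ)) | mid t]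
      =ᵐ[μ] fun ω => ∏ i, trajProb M (softmax ψ (θ t ω)) (x i)
  /-- the update `θ_{t+1} = θ_t + (α/N) ∑ᵢ g(τ_t^{(i)}, θ_t, ∇F(λ̂_t))` -/
  update : ∀ t < T, ∀ ω, θ (t + 1) ω = θ t ω + (α / (N : ℝ)) •
    ∑ i, gEst M ψ (traj t ω i) (θ t ω)
      (gradient F (withPolicy (p (w t ω)) (softmax ψ (θ t ω))))

/-- The estimate `λ̂_t = d̂_t · π_{θ_t}` of the occupancy measure `λ(θ_t)`. -/
def Run.lamHat {M : MDP S A} {d : ℕ} {ψ : S → A → Param d → ℝ} {F : SAVec S A → ℝ}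
    {m : ℕ} {W : Set (Fin m → ℝ)} {p : (Fin m → ℝ) → S → ℝ}
    {Ω : Type*} [MeasurableSpace Ω] {μ : Measure Ω} {T N H n : ℕ} {α : ℝ}
    (R : Run M ψ F W p μ T N H n α) (t : ℕ) (ω : Ω) : SAVec S A :=
  withPolicy (p (R.w t ω)) (softmax ψ (R.θ t ω))

/-- The smoothness constant `L_θ` that enters the step size condition. -/
def Lθ (γ lψ Lψ lF LF : ℝ) : ℝ :=
  4 * LF * lψ ^ 2 / (1 - γ) ^ 4 + 8 * lψ ^ 2 * lF / (1 - γ) ^ 3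
    + 2 * lF * (Lψ + lψ ^ 2) / (1 - γ) ^ 2

/-- The constant `C₃`; it is at most `65 l² / (1-γ)²` when `α ≤ 1/(2 L_θ)`. -/
def C₃ (γ lψ Lψ lF LF l α : ℝ) : ℝ :=
  (Lθ γ lψ Lψ lF LF * α / 2 + 16) * (4 * l ^ 2 / (1 - γ) ^ 2)

/-- The constant `C₄`. -/
def C₄ (γ lψ lF LF : ℝ) : ℝ :=
  5 / 8 * max (8 * lF ^ 2 * lψ ^ 2 / (1 - γ) ^ 4) (8 * lψ ^ 2 * LF ^ 2 / (1 - γ) ^ 4)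

end RLGU

end

set_option linter.unusedSectionVars false

noncomputable section

namespace RLGU

variable {S A : Type*} [Fintype S] [Fintype A]

/-! ### Sums over trajectories -/

/-! The two bounds have different reasons.

For (b), put J(θ) = F(λ(θ)); the run is inexact gradient ascent on J. Trajectory probabilities are
differentiated through their score, and summing geometric series shows that J is smooth with
constant (1 - γ) L_θ (`abs_objective_sub_le`). J need not be concave in θ, but F is concave in λ.
Overparametrization therefore supplies a parameter θ' over the point (1 - η) λ(θ) + η λ(θ*), at
distance at most 2lη from θ, with J(θ') ≥ (1 - η) J(θ) + η J(θ*) (`Overparametrized.exists_lift`).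
One ascent step does as well as moving to θ', up to multiples of ‖θ' - θ‖² and of the squared
gradient error (`inexact_ascent`, `Run.gap_succ_le`). The mean of that squared error splits into a
variance of order 1/N and a squared bias, caused by λ̂ and by the truncation at H
(`sum_gradError_sq_le`). Conditioning on `mid t` turns this into an expectation bound. The gaps then
satisfy x_{t+1} ≤ (1 - η) x_t + K, which is solved by `le_of_affine_recursion`.

For (a), overparametrization on all of ℝ^d is rigid: it forces λ to be constant
(`Overparametrized.lam_eq`). A small step w towards the lift moves λ(θ) towards λ(θ*) by the
fraction η; by differentiability, the step -w moves it away by almost the same fraction. Since λ is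
bounded and this can be done from every point, the distance to λ(θ*) is zero everywhere. Both gaps
in (a) vanish and the right-hand side is nonnegative, so no truncation term is needed. -/

lemma sum_snoc {X E : Type*} [Fintype X] [AddCommMonoid E] {H : ℕ} (f : (Fin (H + 1) → X) → E) :
    ∑ τ, f τ = ∑ τ : Fin H → X, ∑ y, f (Fin.snoc (α := fun _ => X) τ y) := by
  rw [← (Fin.snocEquiv fun _ : Fin (H + 1) => X).sum_comp, Fintype.sum_prod_type, Finset.sum_comm]
  rfl

/-- The law of the next state given the trajectory so far. -/
def stepProb (M : MDP S A) {H : ℕ} (τ : Fin H → S × A) (s : S) : ℝ :=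
  if h : H = 0 then M.ρ s
  else M.P (τ ⟨H - 1, by omega⟩).1 (τ ⟨H - 1, by omega⟩).2 s

lemma stepProb_mem (M : MDP S A) {H : ℕ} (τ : Fin H → S × A) :
    stepProb M τ ∈ stdSimplex ℝ S := by
  by_cases h : H = 0
  · have : stepProb M τ = M.ρ := by ext s; simp [stepProb, h]
    rw [this]; exact M.ρ_mem
  · have : stepProb M τ = M.P (τ ⟨H - 1, by omega⟩).1 (τ ⟨H - 1, by omega⟩).2 := by
      ext s; simp [stepProb, h]
    rw [this]; exact M.P_mem _ _

lemma trajProb_snoc (M : MDP S A) (π : S → A → ℝ) {H : ℕ} (τ : Fin H → S × A) (y : S × A) :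
    trajProb M π (Fin.snoc (α := fun _ => S × A) τ y : Fin (H + 1) → S × A)
      = trajProb M π τ * (stepProb M τ y.1 * π y.1 y.2) := by
  have key : ∀ (k : ℕ) (hk : k < H) (hk' : k < H + 1),
      (Fin.snoc (α := fun _ => S × A) τ y : Fin (H + 1) → S × A) ⟨k, hk'⟩ = τ ⟨k, hk⟩ := by
    intro k hk hk'
    exact Fin.snoc_castSucc (α := fun _ => S × A) y τ ⟨k, hk⟩
  unfold trajProb
  rw [Fin.prod_univ_castSucc]
  congr 1
  · refine Finset.prod_congr rfl fun i _ => ?_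
    have h1 : i.val - 1 < H := lt_of_le_of_lt (Nat.sub_le _ _) i.isLt
    simp only [Fin.snoc_castSucc, Fin.val_castSucc]
    rw [key _ h1]
  · by_cases h : H = 0
    · simp [stepProb, h]
    · have h1 : H - 1 < H := by omega
      simp only [Fin.snoc_last, Fin.val_last, stepProb, h, dif_neg, if_neg, not_false_eq_true]
      rw [key _ h1]

lemma trajProb_nonneg (M : MDP S A) {π : S → A → ℝ} (hπ : ∀ s, π s ∈ stdSimplex ℝ A) {H : ℕ}
    (τ : Fin H → S × A) : 0 ≤ trajProb M π τ := by
  refine Finset.prod_nonneg fun h _ => mul_nonneg ?_ ((hπ _).1 _)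
  split_ifs
  · exact M.ρ_mem.1 _
  · exact (M.P_mem _ _).1 _

lemma sum_stepProb_mul (M : MDP S A) {H : ℕ} (τ : Fin H → S × A) (π : S → A → ℝ) (C : ℝ)
    (hC : ∀ s, ∑ a, π s a ≤ C) : ∑ y : S × A, stepProb M τ y.1 * π y.1 y.2 ≤ C := by
  rw [Fintype.sum_prod_type]
  calc ∑ s, ∑ a, stepProb M τ s * π s a = ∑ s, stepProb M τ s * ∑ a, π s a := by
        simp [Finset.mul_sum]
    _ ≤ ∑ s, stepProb M τ s * C :=
        Finset.sum_le_sum fun s _ => mul_le_mul_of_nonneg_left (hC s) ((stepProb_mem M τ).1 s)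
    _ = C := by rw [← Finset.sum_mul, (stepProb_mem M τ).2, one_mul]

lemma sum_stepProb (M : MDP S A) {π : S → A → ℝ} (hπ : ∀ s, π s ∈ stdSimplex ℝ A) {H : ℕ}
    (τ : Fin H → S × A) : ∑ y : S × A, stepProb M τ y.1 * π y.1 y.2 = 1 := by
  rw [Fintype.sum_prod_type]
  simp [← Finset.mul_sum, (hπ _).2, (stepProb_mem M τ).2]

/-- The weights of the last step sum to one, so it can be marginalized out. Vector values are
allowed because `f` will also be the gradient estimate. -/
lemma sum_trajProb_init {E : Type*} [AddCommGroup E] [Module ℝ E] (M : MDP S A) {π : S → A → ℝ}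
    (hπ : ∀ s, π s ∈ stdSimplex ℝ A) {H : ℕ} (f : (Fin H → S × A) → E) :
    ∑ τ : Fin (H + 1) → S × A, trajProb M π τ • f (Fin.init τ)
      = ∑ τ : Fin H → S × A, trajProb M π τ • f τ := by
  rw [sum_snoc]
  refine Finset.sum_congr rfl fun τ _ => ?_
  simp only [trajProb_snoc, Fin.init_snoc]
  rw [← Finset.sum_smul, ← Finset.mul_sum, sum_stepProb M hπ, mul_one]

lemma sum_trajProb (M : MDP S A) {π : S → A → ℝ} (hπ : ∀ s, π s ∈ stdSimplex ℝ A) (H : ℕ) :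
    ∑ τ : Fin H → S × A, trajProb M π τ = 1 := by
  induction H with
  | zero => simp [trajProb]
  | succ H ih =>
    have := sum_trajProb_init M hπ (H := H) (fun _ => (1 : ℝ))
    simpa [ih] using this

/-- Each step contributes at most `C` in conditional mean. It will be applied to the norms of the
scores, whose mean bound is better than their pointwise bound. -/
lemma sum_trajProb_mul_sum_le (M : MDP S A) {π : S → A → ℝ} (hπ : ∀ s, π s ∈ stdSimplex ℝ A)
    (c : S → A → ℝ) (C : ℝ) (hC : ∀ s, ∑ a, π s a * c s a ≤ C) (H : ℕ) :
    ∑ τ : Fin H → S × A, trajProb M π τ * ∑ t, c (τ t).1 (τ t).2 ≤ H * C := by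
  induction H with
  | zero => simp
  | succ H ih =>
    have h1 := sum_trajProb_init M hπ (H := H) (fun τ => ∑ t, c (τ t).1 (τ t).2)
    simp only [smul_eq_mul] at h1
    have h2 : ∑ τ : Fin (H + 1) → S × A,
        trajProb M π τ * c (τ (Fin.last H)).1 (τ (Fin.last H)).2 ≤ C := by
      rw [sum_snoc]
      calc ∑ τ : Fin H → S × A, ∑ y : S × A, _
          = ∑ τ : Fin H → S × A, trajProb M π τ *
              ∑ y : S × A, stepProb M τ y.1 * (π y.1 y.2 * c y.1 y.2) := by
            refine Finset.sum_congr rfl fun τ _ => ?_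
            rw [Finset.mul_sum]
            refine Finset.sum_congr rfl fun y _ => ?_
            rw [trajProb_snoc, Fin.snoc_last]; ring
        _ ≤ ∑ τ : Fin H → S × A, trajProb M π τ * C :=
            Finset.sum_le_sum fun τ _ => mul_le_mul_of_nonneg_left
              (sum_stepProb_mul M τ (fun s a => π s a * c s a) C hC) (trajProb_nonneg M hπ τ)
        _ = C := by rw [← Finset.sum_mul, sum_trajProb M hπ, one_mul]
    calc _ = ∑ τ : Fin (H + 1) → S × A, (trajProb M π τ *
            (∑ t, c (Fin.init (α := fun _ => S × A) τ t).1 (Fin.init (α := fun _ => S × A) τ t).2)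
            + trajProb M π τ * c (τ (Fin.last H)).1 (τ (Fin.last H)).2) := by
          refine Finset.sum_congr rfl fun τ _ => ?_
          rw [Fin.sum_univ_castSucc, mul_add]
          rfl
      _ ≤ H * C + C := by
          rw [Finset.sum_add_distrib]
          exact add_le_add (h1.le.trans ih) h2
      _ = _ := by push_cast; ring

/-! ### The law of the state-action pair at a fixed time -/

open scoped Classical in
/-- The unit vector of a state-action pair. -/
def unitVec (x : S × A) : SAVec S A := EuclideanSpace.single x 1

lemma norm_unitVec (x : S × A) : ‖unitVec x‖ = 1 := by simp [unitVec]

lemma inner_unitVec (x : S × A) (r : SAVec S A) : inner ℝ r (unitVec x) = r x := by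
  classical
  simp [unitVec, EuclideanSpace.inner_single_right]

/-- The law of the state-action pair at time `h`. -/
def occAt (M : MDP S A) (π : S → A → ℝ) (h : ℕ) : SAVec S A :=
  ∑ τ : Fin (h + 1) → S × A, trajProb M π τ • unitVec (τ (Fin.last h))

lemma norm_occAt_le (M : MDP S A) {π : S → A → ℝ} (hπ : ∀ s, π s ∈ stdSimplex ℝ A) (h : ℕ) :
    ‖occAt M π h‖ ≤ 1 := by
  refine (norm_sum_le _ _).trans ?_
  simp only [norm_smul, norm_unitVec, mul_one, Real.norm_eq_abs]
  rw [← sum_trajProb M hπ (h + 1)]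
  exact Finset.sum_le_sum fun τ _ => (abs_of_nonneg (trajProb_nonneg M hπ τ)).le

lemma stateProb_eq (M : MDP S A) {π : S → A → ℝ} (hπ : ∀ s, π s ∈ stdSimplex ℝ A) (h : ℕ) (s : S) :
    stateProb M π h s = ∑ τ : Fin h → S × A, trajProb M π τ * stepProb M τ s := by
  classical
  unfold stateProb
  rw [sum_snoc]
  refine Finset.sum_congr rfl fun τ _ => ?_
  simp only [trajProb_snoc, Fin.snoc_last]
  rw [Fintype.sum_prod_type, Finset.sum_eq_single s]
  · simp only [if_true]
    rw [← Finset.mul_sum, ← Finset.mul_sum, (hπ s).2, mul_one]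
  · intro b _ hb; simp [hb]
  · simp

lemma occAt_apply (M : MDP S A) {π : S → A → ℝ} (hπ : ∀ s, π s ∈ stdSimplex ℝ A) (h : ℕ)
    (x : S × A) : occAt M π h x = stateProb M π h x.1 * π x.1 x.2 := by
  classical
  rw [stateProb_eq M hπ, occAt, sum_snoc, Finset.sum_mul]
  simp only [trajProb_snoc, Fin.snoc_last, PiLp.smul_apply, WithLp.ofLp_sum, Finset.sum_apply,
    unitVec]
  refine Finset.sum_congr rfl fun τ _ => ?_
  rw [Finset.sum_eq_single x]
  · simp; ring
  · intro b _ hb; simp [hb.symm]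
  · simp

lemma summable_occAt (M : MDP S A) {π : S → A → ℝ} (hπ : ∀ s, π s ∈ stdSimplex ℝ A) :
    Summable fun h : ℕ => M.γ ^ h • occAt M π h := by
  refine Summable.of_norm_bounded (summable_geometric_of_lt_one M.γ_pos.le M.γ_lt_one) fun h => ?_
  rw [norm_smul, Real.norm_eq_abs, abs_of_nonneg (pow_nonneg M.γ_pos.le h)]
  exact mul_le_of_le_one_right (pow_nonneg M.γ_pos.le h) (norm_occAt_le M hπ h)

/-- This geometric mixture of the laws `occAt` is what gets differentiated term by term in θ. -/
lemma occ_eq_tsum (M : MDP S A) {π : S → A → ℝ} (hπ : ∀ s, π s ∈ stdSimplex ℝ A) :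
    occ M π = (1 - M.γ) • ∑' h : ℕ, M.γ ^ h • occAt M π h := by
  ext x
  have h1 := (EuclideanSpace.proj x : SAVec S A →L[ℝ] ℝ).map_tsum (summable_occAt M hπ)
  simp only [PiLp.proj_apply, PiLp.smul_apply, smul_eq_mul] at h1
  rw [PiLp.smul_apply, h1]
  simp only [occ, withPolicy, stateOcc, occAt_apply M hπ, smul_eq_mul, ← mul_assoc]
  rw [tsum_mul_right, mul_assoc]

lemma norm_occ_le (M : MDP S A) {π : S → A → ℝ} (hπ : ∀ s, π s ∈ stdSimplex ℝ A) :
    ‖occ M π‖ ≤ 1 := by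
  have hβ : 0 < 1 - M.γ := sub_pos.2 M.γ_lt_one
  have h1 : ‖∑' h : ℕ, M.γ ^ h • occAt M π h‖ ≤ (1 - M.γ)⁻¹ := by
    refine tsum_of_norm_bounded (hasSum_geometric_of_lt_one M.γ_pos.le M.γ_lt_one) fun h => ?_
    rw [norm_smul, Real.norm_eq_abs, abs_of_nonneg (pow_nonneg M.γ_pos.le h)]
    exact mul_le_of_le_one_right (pow_nonneg M.γ_pos.le h) (norm_occAt_le M hπ h)
  rw [occ_eq_tsum M hπ, norm_smul, Real.norm_eq_abs, abs_of_pos hβ]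
  calc _ ≤ (1 - M.γ) * (1 - M.γ)⁻¹ := by gcongr
    _ = 1 := mul_inv_cancel₀ hβ.ne'

lemma norm_withPolicy_le {q : S → ℝ} (hq : q ∈ stdSimplex ℝ S) {π : S → A → ℝ}
    (hπ : ∀ s, π s ∈ stdSimplex ℝ A) : ‖withPolicy q π‖ ≤ 1 := by
  classical
  have h1 : withPolicy q π = ∑ x : S × A, (q x.1 * π x.1 x.2) • unitVec x := by
    ext x
    simp [withPolicy, unitVec, Pi.single_apply]
  rw [h1]
  refine (norm_sum_le _ _).trans ?_
  simp only [norm_smul, norm_unitVec, mul_one, Real.norm_eq_abs]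
  rw [Fintype.sum_prod_type]
  simp only [abs_mul, abs_of_nonneg (hq.1 _), abs_of_nonneg ((hπ _).1 _), ← Finset.mul_sum,
    (hπ _).2, mul_one, hq.2, le_refl]

/-! ### The mean square error of an average of i.i.d. vectors -/

/-- Variances of independent centred vectors add. Peeling off the last vector changes the shift `v`
into `g y + v`, hence the induction over all `v`; centring kills the cross term. -/
lemma sum_prod_norm_sum_sq {X E : Type*} [Fintype X] [NormedAddCommGroup E] [InnerProductSpace ℝ E]
    (p : X → ℝ) (hp : ∑ x, p x = 1) (g : X → E) (hg : ∑ x, p x • g x = 0) (N : ℕ) (v : E) :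
    ∑ x : Fin N → X, (∏ i, p (x i)) * ‖∑ i, g (x i) + v‖ ^ 2
      = N * ∑ x, p x * ‖g x‖ ^ 2 + ‖v‖ ^ 2 := by
  induction N generalizing v with
  | zero => simp
  | succ N ih =>
    rw [sum_snoc, Finset.sum_comm]
    have h1 : ∀ y : X, ∑ x : Fin N → X,
        (∏ i, p ((Fin.snoc (α := fun _ => X) x y : Fin (N + 1) → X) i)) *
          ‖∑ i, g ((Fin.snoc (α := fun _ => X) x y : Fin (N + 1) → X) i) + v‖ ^ 2
        = p y * (N * ∑ x, p x * ‖g x‖ ^ 2 + ‖g y + v‖ ^ 2) := by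
      intro y
      rw [← ih, Finset.mul_sum]
      refine Finset.sum_congr rfl fun x _ => ?_
      simp only [Fin.prod_univ_castSucc, Fin.sum_univ_castSucc, Fin.snoc_castSucc, Fin.snoc_last,
        add_assoc]
      ring
    have h2 : ∑ y, p y * inner ℝ (g y) v = 0 := by
      have := congrArg (fun z => inner ℝ z v) hg
      simpa [sum_inner, inner_smul_left] using this
    calc _ = ∑ y, p y * (N * ∑ x, p x * ‖g x‖ ^ 2 + ‖g y + v‖ ^ 2) :=
          Finset.sum_congr rfl fun y _ => h1 y
      _ = ∑ y, (p y * (N * ∑ x, p x * ‖g x‖ ^ 2 + ‖v‖ ^ 2) + p y * ‖g y‖ ^ 2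
            + 2 * (p y * inner ℝ (g y) v)) := by
          refine Finset.sum_congr rfl fun y _ => ?_
          rw [norm_add_sq_real]; ring
      _ = _ := by
          rw [Finset.sum_add_distrib, Finset.sum_add_distrib, ← Finset.sum_mul, ← Finset.mul_sum,
            hp, h2]
          push_cast; ring

/-- The variance is at most the second moment. This serves both the trajectory estimates and the
scores, a score being a preference gradient minus its mean under the policy. -/
lemma sum_mul_norm_sub_sq_le {X E : Type*} [Fintype X] [NormedAddCommGroup E]
    [InnerProductSpace ℝ E] (p : X → ℝ) (hp0 : ∀ x, 0 ≤ p x) (hp : ∑ x, p x = 1) (g : X → E)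
    (B : ℝ) (hB : ∀ x, ‖g x‖ ≤ B) :
    ∑ x, p x * ‖g x - ∑ y, p y • g y‖ ^ 2 ≤ B ^ 2 := by
  set m := ∑ x, p x • g x with hm
  have e1 : ∑ x, p x * inner ℝ (g x) m = ‖m‖ ^ 2 := by
    have := congrArg (fun z => inner ℝ z m) hm
    simp only [sum_inner, inner_smul_left, real_inner_self_eq_norm_sq] at this
    simpa using this.symm
  calc ∑ x, p x * ‖g x - m‖ ^ 2
      = ∑ x, (p x * ‖g x‖ ^ 2 - 2 * (p x * inner ℝ (g x) m) + p x * ‖m‖ ^ 2) := by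
        refine Finset.sum_congr rfl fun x _ => ?_
        rw [norm_sub_sq_real]; ring
    _ = ∑ x, p x * ‖g x‖ ^ 2 - ‖m‖ ^ 2 := by
        rw [Finset.sum_add_distrib, Finset.sum_sub_distrib, ← Finset.mul_sum, ← Finset.sum_mul,
          hp, e1]
        ring
    _ ≤ ∑ x, p x * ‖g x‖ ^ 2 := sub_le_self _ (sq_nonneg _)
    _ ≤ ∑ x, p x * B ^ 2 := by
        gcongr with x
        · exact hp0 x
        · exact hB x
    _ = B ^ 2 := by rw [← Finset.sum_mul, hp, one_mul]

/-- Bias-variance decomposition: the preceding identity with centred vectors and shift `N • (m -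
D)`. -/
lemma sum_prod_norm_average_sub_sq_le {X E : Type*} [Fintype X] [NormedAddCommGroup E]
    [InnerProductSpace ℝ E] (p : X → ℝ) (hp0 : ∀ x, 0 ≤ p x) (hp : ∑ x, p x = 1) (g : X → E)
    (B : ℝ) (hB : ∀ x, ‖g x‖ ≤ B) {N : ℕ} (hN : 1 ≤ N) (D : E) :
    ∑ x : Fin N → X, (∏ i, p (x i)) * ‖(1 / (N : ℝ)) • ∑ i, g (x i) - D‖ ^ 2
      ≤ B ^ 2 / N + ‖∑ x, p x • g x - D‖ ^ 2 := by
  have hN0 : (0 : ℝ) < N := by exact_mod_cast hN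
  set m := ∑ x, p x • g x with hm
  have hc : ∑ x, p x • (g x - m) = 0 := by
    simp only [smul_sub, Finset.sum_sub_distrib, ← Finset.sum_smul, hp, one_smul, ← hm, sub_self]
  have h1 := sum_prod_norm_sum_sq p hp (fun x => g x - m) hc N ((N : ℝ) • (m - D))
  have h2 : ∀ x : Fin N → X, (∏ i, p (x i)) * ‖(1 / (N : ℝ)) • ∑ i, g (x i) - D‖ ^ 2
      = (1 / (N : ℝ)) ^ 2 *
        ((∏ i, p (x i)) * ‖∑ i, (g (x i) - m) + (N : ℝ) • (m - D)‖ ^ 2) := by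
    intro x
    have : (1 / (N : ℝ)) • ∑ i, g (x i) - D
        = (1 / (N : ℝ)) • (∑ i, (g (x i) - m) + (N : ℝ) • (m - D)) := by
      rw [Finset.sum_sub_distrib, Finset.sum_const, Finset.card_univ, Fintype.card_fin,
        ← Nat.cast_smul_eq_nsmul ℝ, smul_sub (N : ℝ), sub_add_sub_cancel, smul_sub, smul_smul]
      rw [one_div_mul_cancel hN0.ne', one_smul]
    rw [this, norm_smul, mul_pow, Real.norm_eq_abs, sq_abs]
    ring
  have h3 := sum_mul_norm_sub_sq_le p hp0 hp g B hB
  rw [Finset.sum_congr rfl fun x _ => h2 x, ← Finset.mul_sum, h1, norm_smul, Real.norm_eq_abs,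
    mul_pow, sq_abs]
  calc _ = (∑ x, p x * ‖g x - m‖ ^ 2) / N + ‖m - D‖ ^ 2 := by field_simp
    _ ≤ _ := by gcongr

/-! ### Softmax policies -/

section Softmax

variable [Nonempty A] {d : ℕ} {ψ : S → A → Param d → ℝ} {lψ Lψ : ℝ}

lemma softmax_pos (ψ : S → A → Param d → ℝ) (θ : Param d) (s : S) (a : A) :
    0 < softmax ψ θ s a :=
  div_pos (Real.exp_pos _) (Finset.sum_pos (fun _ _ => Real.exp_pos _) Finset.univ_nonempty)

lemma softmax_mem (ψ : S → A → Param d → ℝ) (θ : Param d) (s : S) :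
    softmax ψ θ s ∈ stdSimplex ℝ A := by
  refine ⟨fun a => (softmax_pos ψ θ s a).le, ?_⟩
  simp only [softmax]
  rw [← Finset.sum_div]
  exact div_self (Finset.sum_pos (fun _ _ => Real.exp_pos _) Finset.univ_nonempty).ne'

lemma PolicyRegular.differentiable (hψ : PolicyRegular ψ lψ Lψ) (s : S) (a : A) :
    Differentiable ℝ (ψ s a) := (hψ.contDiff s a).differentiable (by norm_num)

lemma hasGradientAt_log_softmax (hψ : PolicyRegular ψ lψ Lψ) (θ : Param d) (s : S) (a : A) :
    HasGradientAt (fun θ' => Real.log (softmax ψ θ' s a))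
      (gradient (ψ s a) θ - ∑ b, softmax ψ θ s b • gradient (ψ s b) θ) θ := by
  have hZ : ∀ θ' : Param d, 0 < ∑ b, Real.exp (ψ s b θ') := fun θ' =>
    Finset.sum_pos (fun _ _ => Real.exp_pos _) Finset.univ_nonempty
  have h0 : (fun θ' => Real.log (softmax ψ θ' s a))
      = fun θ' => ψ s a θ' - Real.log (∑ b, Real.exp (ψ s b θ')) := by
    funext θ'
    rw [softmax, Real.log_div (Real.exp_pos _).ne' (hZ θ').ne', Real.log_exp]
  have h1 : ∀ b, HasFDerivAt (ψ s b) (fderiv ℝ (ψ s b) θ) θ := fun b =>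
    (hψ.differentiable s b θ).hasFDerivAt
  have h2 : HasFDerivAt (fun θ' => ∑ b, Real.exp (ψ s b θ'))
      (∑ b, Real.exp (ψ s b θ) • fderiv ℝ (ψ s b) θ) θ :=
    HasFDerivAt.fun_sum fun b _ => (h1 b).exp
  rw [h0, hasGradientAt_iff_hasFDerivAt]
  refine ((h1 a).sub (h2.log (hZ θ).ne')).congr_fderiv ?_
  simp only [map_sub, map_sum, map_smulₛₗ, gradient, LinearIsometryEquiv.apply_symm_apply,
    Finset.smul_sum, smul_smul, conj_trivial, softmax, div_eq_inv_mul]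

lemma score_eq (hψ : PolicyRegular ψ lψ Lψ) (θ : Param d) (s : S) (a : A) :
    score ψ θ s a = gradient (ψ s a) θ - ∑ b, softmax ψ θ s b • gradient (ψ s b) θ :=
  (hasGradientAt_log_softmax hψ θ s a).gradient

lemma norm_score_le (hψ : PolicyRegular ψ lψ Lψ) (θ : Param d) (s : S) (a : A) :
    ‖score ψ θ s a‖ ≤ 2 * lψ := by
  rw [score_eq hψ]
  have h1 : ‖∑ b, softmax ψ θ s b • gradient (ψ s b) θ‖ ≤ lψ := by
    refine (norm_sum_le _ _).trans ?_
    calc _ ≤ ∑ b, softmax ψ θ s b * lψ := by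
          refine Finset.sum_le_sum fun b _ => ?_
          rw [norm_smul, Real.norm_eq_abs, abs_of_pos (softmax_pos ψ θ s b)]
          exact mul_le_mul_of_nonneg_left (hψ.grad_le s b θ) (softmax_pos ψ θ s b).le
      _ = lψ := by rw [← Finset.sum_mul, (softmax_mem ψ θ s).2, one_mul]
  linarith [norm_sub_le (gradient (ψ s a) θ) (∑ b, softmax ψ θ s b • gradient (ψ s b) θ),
    hψ.grad_le s a θ]

/-- The second moment of the score is a variance, hence at most `lψ ^ 2`; the inequality 2xy ≤ x² +
y² passes to the first moment. This gains a factor two over `norm_score_le`. -/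
lemma sum_softmax_mul_norm_score_le (hψ : PolicyRegular ψ lψ Lψ) (θ : Param d) (s : S) :
    ∑ a, softmax ψ θ s a * ‖score ψ θ s a‖ ≤ lψ := by
  have h1 := sum_mul_norm_sub_sq_le (softmax ψ θ s) (softmax_mem ψ θ s).1 (softmax_mem ψ θ s).2
    (fun a => gradient (ψ s a) θ) lψ (fun a => hψ.grad_le s a θ)
  simp only [← score_eq hψ] at h1
  have hl := hψ.lψ_pos
  calc _ ≤ ∑ a, softmax ψ θ s a * ((‖score ψ θ s a‖ ^ 2 + lψ ^ 2) / (2 * lψ)) := by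
        refine Finset.sum_le_sum fun a _ =>
          mul_le_mul_of_nonneg_left ?_ (softmax_pos ψ θ s a).le
        rw [le_div_iff₀ (by positivity)]
        nlinarith [sq_nonneg (‖score ψ θ s a‖ - lψ)]
    _ = (∑ a, softmax ψ θ s a * ‖score ψ θ s a‖ ^ 2 + lψ ^ 2) / (2 * lψ) := by
        simp only [← mul_div_assoc, ← Finset.sum_div, mul_add, Finset.sum_add_distrib,
          ← Finset.sum_mul, (softmax_mem ψ θ s).2, one_mul]
    _ ≤ (lψ ^ 2 + lψ ^ 2) / (2 * lψ) := by gcongr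
    _ = lψ := by field_simp; ring

lemma continuous_gradient (hψ : PolicyRegular ψ lψ Lψ) (s : S) (a : A) :
    Continuous (gradient (ψ s a)) :=
  (LinearIsometryEquiv.continuous _).comp ((hψ.contDiff s a).continuous_fderiv (by norm_num))

lemma continuous_softmax (hψ : PolicyRegular ψ lψ Lψ) (s : S) (a : A) :
    Continuous fun θ => softmax ψ θ s a := by
  unfold softmax
  refine Continuous.div ?_ ?_ fun θ =>
    (Finset.sum_pos (fun _ _ => Real.exp_pos _) Finset.univ_nonempty).ne'
  · exact Real.continuous_exp.comp (hψ.contDiff s a).continuous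
  · exact continuous_finsetSum _ fun b _ =>
      Real.continuous_exp.comp (hψ.contDiff s b).continuous

lemma continuous_score (hψ : PolicyRegular ψ lψ Lψ) (s : S) (a : A) :
    Continuous fun θ => score ψ θ s a := by
  simp only [score_eq hψ]
  exact (continuous_gradient hψ s a).sub (continuous_finsetSum _ fun b _ =>
    (continuous_softmax hψ s b).smul (continuous_gradient hψ s b))

lemma continuous_trajProb (M : MDP S A) (hψ : PolicyRegular ψ lψ Lψ) {H : ℕ} (τ : Fin H → S × A) :
    Continuous fun θ => trajProb M (softmax ψ θ) τ :=
  continuous_finsetProd _ fun _ _ => continuous_const.mul (continuous_softmax hψ _ _)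

/-! ### Derivatives along a line -/

lemma hasDerivAt_line {E : Type*} [NormedAddCommGroup E] [NormedSpace ℝ E] (θ u : E) (s : ℝ) :
    HasDerivAt (fun s : ℝ => θ + s • u) u s := by
  simpa using ((hasDerivAt_id s).smul_const u).const_add θ

lemma hasDerivAt_softmax_line (hψ : PolicyRegular ψ lψ Lψ) (θ u : Param d) (x : S) (a : A) (s : ℝ) :
    HasDerivAt (fun s : ℝ => softmax ψ (θ + s • u) x a)
      (softmax ψ (θ + s • u) x a * inner ℝ (score ψ (θ + s • u) x a) u) s := by
  have h1 := (hasGradientAt_log_softmax hψ (θ + s • u) x a).hasFDerivAt.comp_hasDerivAt s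
    (hasDerivAt_line θ u s)
  rw [← score_eq hψ] at h1
  have h2 := h1.exp
  simpa only [Function.comp_def, Real.exp_log (softmax_pos ψ _ x a),
    InnerProductSpace.toDual_apply_apply] using h2

lemma hasDerivAt_inner_gradient_line (hψ : PolicyRegular ψ lψ Lψ) (θ u : Param d) (x : S) (a : A)
    (s : ℝ) :
    HasDerivAt (fun s : ℝ => inner ℝ (gradient (ψ x a) (θ + s • u)) u)
      (fderiv ℝ (fderiv ℝ (ψ x a)) (θ + s • u) u u) s := by
  have h1 : Differentiable ℝ (fderiv ℝ (ψ x a)) :=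
    ((hψ.contDiff x a).fderiv_right (m := 1) (by norm_num)).differentiable (by norm_num)
  have h2 : HasDerivAt (fun s : ℝ => fderiv ℝ (ψ x a) (θ + s • u))
      (fderiv ℝ (fderiv ℝ (ψ x a)) (θ + s • u) u) s :=
    (h1 (θ + s • u)).hasFDerivAt.comp_hasDerivAt s (hasDerivAt_line θ u s)
  have h3 : (fun s : ℝ => inner ℝ (gradient (ψ x a) (θ + s • u)) u)
      = fun s : ℝ => fderiv ℝ (ψ x a) (θ + s • u) u := by
    funext s
    rw [gradient, InnerProductSpace.toDual_symm_apply]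
  rw [h3]
  exact (ContinuousLinearMap.apply ℝ ℝ u).hasFDerivAt.comp_hasDerivAt s h2

lemma abs_inner_gradient_le (hψ : PolicyRegular ψ lψ Lψ) (θ u : Param d) (x : S) (a : A) :
    |inner ℝ (gradient (ψ x a) θ) u| ≤ lψ * ‖u‖ :=
  (abs_real_inner_le_norm _ _).trans
    (mul_le_mul_of_nonneg_right (hψ.grad_le x a θ) (norm_nonneg u))

/-- One `Lψ` comes from the Hessian of the preference of `a`. The policy average contributes `Lψ + 2
* lψ ^ 2`, the second term from differentiating its weights. -/
lemma exists_hasDerivAt_inner_score (hψ : PolicyRegular ψ lψ Lψ) (θ u : Param d) (x : S) (a : A)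
    (s : ℝ) :
    ∃ k, HasDerivAt (fun s : ℝ => inner ℝ (score ψ (θ + s • u) x a) u) k s ∧
      |k| ≤ (2 * Lψ + 2 * lψ ^ 2) * ‖u‖ ^ 2 := by
  have h0 : (fun s : ℝ => inner ℝ (score ψ (θ + s • u) x a) u)
      = fun s : ℝ => inner ℝ (gradient (ψ x a) (θ + s • u)) u
        - ∑ b, softmax ψ (θ + s • u) x b * inner ℝ (gradient (ψ x b) (θ + s • u)) u := by
    funext s
    simp [score_eq hψ, inner_sub_left, sum_inner, inner_smul_left]
  have hH : ∀ b, |fderiv ℝ (fderiv ℝ (ψ x b)) (θ + s • u) u u| ≤ Lψ * ‖u‖ ^ 2 := fun b => by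
    have := ContinuousLinearMap.le_opNorm₂ (fderiv ℝ (fderiv ℝ (ψ x b)) (θ + s • u)) u u
    rw [Real.norm_eq_abs, mul_assoc, ← sq] at this
    exact this.trans (mul_le_mul_of_nonneg_right (hψ.hess_le x b _) (sq_nonneg _))
  rw [h0]
  refine ⟨_, (hasDerivAt_inner_gradient_line hψ θ u x a s).fun_sub
    (HasDerivAt.fun_sum fun b _ => (hasDerivAt_softmax_line hψ θ u x b s).fun_mul
      (hasDerivAt_inner_gradient_line hψ θ u x b s)), ?_⟩
  have h1 : |∑ b, (softmax ψ (θ + s • u) x b * inner ℝ (score ψ (θ + s • u) x b) u *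
      inner ℝ (gradient (ψ x b) (θ + s • u)) u +
      softmax ψ (θ + s • u) x b * fderiv ℝ (fderiv ℝ (ψ x b)) (θ + s • u) u u)|
      ≤ (2 * lψ ^ 2 + Lψ) * ‖u‖ ^ 2 := by
    refine (Finset.abs_sum_le_sum_abs _ _).trans ?_
    calc _ ≤ ∑ b, softmax ψ (θ + s • u) x b * ((2 * lψ ^ 2 + Lψ) * ‖u‖ ^ 2) := by
          refine Finset.sum_le_sum fun b _ => ?_
          rw [mul_assoc, ← mul_add, abs_mul, abs_of_pos (softmax_pos ψ _ x b)]
          refine mul_le_mul_of_nonneg_left ?_ (softmax_pos ψ _ x b).le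
          refine (abs_add_le _ _).trans ?_
          rw [abs_mul, add_mul]
          refine add_le_add ?_ (hH b)
          have e1 : |inner ℝ (score ψ (θ + s • u) x b) u| ≤ 2 * lψ * ‖u‖ :=
            (abs_real_inner_le_norm _ _).trans
              (mul_le_mul_of_nonneg_right (norm_score_le hψ _ x b) (norm_nonneg u))
          calc _ ≤ 2 * lψ * ‖u‖ * (lψ * ‖u‖) :=
                mul_le_mul e1 (abs_inner_gradient_le hψ _ u x b) (abs_nonneg _)
                  ((abs_nonneg _).trans e1)
            _ = _ := by ring
      _ = _ := by rw [← Finset.sum_mul, (softmax_mem ψ _ x).2, one_mul]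
  refine (abs_sub _ _).trans ?_
  linarith [hH a]

/-! ### Likelihood-ratio derivatives of trajectory probabilities -/

/-- The score of a trajectory: the sum of the scores of its state-action pairs. -/
def trajScore (ψ : S → A → Param d → ℝ) (θ : Param d) {H : ℕ} (τ : Fin H → S × A) : Param d :=
  ∑ t, score ψ θ (τ t).1 (τ t).2

lemma norm_trajScore_le (hψ : PolicyRegular ψ lψ Lψ) (θ : Param d) {H : ℕ} (τ : Fin H → S × A) :
    ‖trajScore ψ θ τ‖ ≤ H * (2 * lψ) := by
  refine (norm_sum_le _ _).trans ?_
  refine (Finset.sum_le_sum fun t _ => norm_score_le hψ θ (τ t).1 (τ t).2).trans ?_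
  simp

lemma sum_trajProb_mul_norm_trajScore_le (M : MDP S A) (hψ : PolicyRegular ψ lψ Lψ) (θ : Param d)
    (H : ℕ) : ∑ τ : Fin H → S × A, trajProb M (softmax ψ θ) τ * ‖trajScore ψ θ τ‖ ≤ H * lψ := by
  refine le_trans (Finset.sum_le_sum fun τ _ => ?_) (sum_trajProb_mul_sum_le M (softmax_mem ψ θ)
    (fun s a => ‖score ψ θ s a‖) lψ (sum_softmax_mul_norm_score_le hψ θ) H)
  exact mul_le_mul_of_nonneg_left (norm_sum_le _ _) (trajProb_nonneg M (softmax_mem ψ θ) τ)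

lemma hasDerivAt_trajProb_line (M : MDP S A) (hψ : PolicyRegular ψ lψ Lψ) (θ u : Param d) {H : ℕ}
    (τ : Fin H → S × A) (s : ℝ) :
    HasDerivAt (fun s : ℝ => trajProb M (softmax ψ (θ + s • u)) τ)
      (trajProb M (softmax ψ (θ + s • u)) τ * inner ℝ (trajScore ψ (θ + s • u) τ) u) s := by
  classical
  have h1 := HasDerivAt.fun_finsetProd (u := Finset.univ) (x := s) fun (h : Fin H) _ =>
    (hasDerivAt_softmax_line hψ θ u (τ h).1 (τ h).2 s).const_mul
      (if h.val = 0 then M.ρ (τ h).1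
      else
        M.P (τ ⟨h.val - 1, lt_of_le_of_lt (Nat.sub_le _ _) h.isLt⟩).1
          (τ ⟨h.val - 1, lt_of_le_of_lt (Nat.sub_le _ _) h.isLt⟩).2 (τ h).1)
  refine h1.congr_deriv ?_
  symm
  rw [trajScore, sum_inner, Finset.mul_sum]
  refine Finset.sum_congr rfl fun h _ => ?_
  rw [smul_eq_mul, ← mul_assoc _ (softmax ψ (θ + s • u) (τ h).1 (τ h).2), ← mul_assoc,
    Finset.prod_erase_mul _ _ (Finset.mem_univ h)]
  rfl

lemma exists_hasDerivAt_inner_trajScore (hψ : PolicyRegular ψ lψ Lψ) (θ u : Param d) {H : ℕ}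
    (τ : Fin H → S × A) (s : ℝ) :
    ∃ k, HasDerivAt (fun s : ℝ => inner ℝ (trajScore ψ (θ + s • u) τ) u) k s ∧
      |k| ≤ H * ((2 * Lψ + 2 * lψ ^ 2) * ‖u‖ ^ 2) := by
  choose k hk hk' using fun t : Fin H =>
    exists_hasDerivAt_inner_score hψ θ u (τ t).1 (τ t).2 s
  refine ⟨∑ t, k t, ?_, ?_⟩
  · simp only [trajScore, sum_inner]
    exact HasDerivAt.fun_sum fun t _ => hk t
  · refine (Finset.abs_sum_le_sum_abs _ _).trans ((Finset.sum_le_sum fun t _ => hk' t).trans ?_)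
    simp

/-- The derivative of `occAt` at `θ` in the direction `u`. -/
def occAtDir (M : MDP S A) (ψ : S → A → Param d → ℝ) (θ u : Param d) (h : ℕ) : SAVec S A :=
  ∑ τ : Fin (h + 1) → S × A,
    (trajProb M (softmax ψ θ) τ * inner ℝ (trajScore ψ θ τ) u) • unitVec (τ (Fin.last h))

lemma hasDerivAt_occAt_line (M : MDP S A) (hψ : PolicyRegular ψ lψ Lψ) (θ u : Param d) (h : ℕ)
    (s : ℝ) :
    HasDerivAt (fun s : ℝ => occAt M (softmax ψ (θ + s • u)) h)
      (occAtDir M ψ (θ + s • u) u h) s :=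
  HasDerivAt.fun_sum fun τ _ => (hasDerivAt_trajProb_line M hψ θ u τ s).smul_const _

lemma norm_occAtDir_le (M : MDP S A) (hψ : PolicyRegular ψ lψ Lψ) (θ u : Param d) (h : ℕ) :
    ‖occAtDir M ψ θ u h‖ ≤ (h + 1) * (lψ * ‖u‖) := by
  have h1 := sum_trajProb_mul_norm_trajScore_le M hψ θ (h + 1)
  refine (norm_sum_le _ _).trans ?_
  calc _ ≤ ∑ τ : Fin (h + 1) → S × A,
        trajProb M (softmax ψ θ) τ * ‖trajScore ψ θ τ‖ * ‖u‖ := by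
        refine Finset.sum_le_sum fun τ _ => ?_
        rw [norm_smul, norm_unitVec, mul_one, Real.norm_eq_abs, abs_mul,
          abs_of_nonneg (trajProb_nonneg M (softmax_mem ψ θ) τ), mul_assoc]
        exact mul_le_mul_of_nonneg_left (abs_real_inner_le_norm _ _)
          (trajProb_nonneg M (softmax_mem ψ θ) τ)
    _ ≤ ((h + 1 : ℕ) * lψ) * ‖u‖ := by
        rw [← Finset.sum_mul]
        exact mul_le_mul_of_nonneg_right h1 (norm_nonneg u)
    _ = _ := by push_cast; ring

/-- The second derivative of a trajectory probability is the probability times the squared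
directional score plus the derivative of that score. The first is quadratic in the length `h + 1`,
the second linear. -/
lemma norm_occAtDir_sub_le (M : MDP S A) (hψ : PolicyRegular ψ lψ Lψ) (θ u : Param d) (h : ℕ)
    (s : ℝ) :
    ‖occAtDir M ψ (θ + s • u) u h - occAtDir M ψ θ u h‖
      ≤ (((h + 1) ^ 2 * (4 * lψ ^ 2) + (h + 1) * (2 * Lψ + 2 * lψ ^ 2)) * ‖u‖ ^ 2) * |s| := by
  choose k hk hk' using fun (s : ℝ) (τ : Fin (h + 1) → S × A) =>
    exists_hasDerivAt_inner_trajScore hψ θ u τ s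
  have hd : ∀ s : ℝ, HasDerivAt (fun s : ℝ => occAtDir M ψ (θ + s • u) u h)
      (∑ τ : Fin (h + 1) → S × A, (trajProb M (softmax ψ (θ + s • u)) τ
          * inner ℝ (trajScore ψ (θ + s • u) τ) u * inner ℝ (trajScore ψ (θ + s • u) τ) u
        + trajProb M (softmax ψ (θ + s • u)) τ * k s τ) • unitVec (τ (Fin.last h))) s := fun s =>
    HasDerivAt.fun_sum fun τ _ =>
      ((hasDerivAt_trajProb_line M hψ θ u τ s).mul (hk s τ)).smul_const _
  have hb : ∀ s : ℝ, ‖∑ τ : Fin (h + 1) → S × A, (trajProb M (softmax ψ (θ + s • u)) τ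
          * inner ℝ (trajScore ψ (θ + s • u) τ) u * inner ℝ (trajScore ψ (θ + s • u) τ) u
        + trajProb M (softmax ψ (θ + s • u)) τ * k s τ) • unitVec (τ (Fin.last h))‖
      ≤ ((h + 1) ^ 2 * (4 * lψ ^ 2) + (h + 1) * (2 * Lψ + 2 * lψ ^ 2)) * ‖u‖ ^ 2 := by
    intro s
    refine (norm_sum_le _ _).trans ?_
    calc _ ≤ ∑ τ : Fin (h + 1) → S × A, trajProb M (softmax ψ (θ + s • u)) τ *
          (((h + 1) ^ 2 * (4 * lψ ^ 2) + (h + 1) * (2 * Lψ + 2 * lψ ^ 2)) * ‖u‖ ^ 2) := by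
          refine Finset.sum_le_sum fun τ _ => ?_
          have hp := trajProb_nonneg M (softmax_mem ψ (θ + s • u)) τ
          rw [norm_smul, norm_unitVec, mul_one, Real.norm_eq_abs, mul_assoc, ← mul_add, abs_mul,
            abs_of_nonneg hp]
          refine mul_le_mul_of_nonneg_left ((abs_add_le _ _).trans ?_) hp
          rw [add_mul]
          have e1 : |inner ℝ (trajScore ψ (θ + s • u) τ) u| ≤ (h + 1) * (2 * lψ) * ‖u‖ := by
            refine (abs_real_inner_le_norm _ _).trans
              (mul_le_mul_of_nonneg_right ?_ (norm_nonneg u))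
            exact_mod_cast norm_trajScore_le hψ (θ + s • u) τ
          refine add_le_add ?_ ?_
          · rw [← sq, abs_pow]
            calc _ ≤ ((h + 1) * (2 * lψ) * ‖u‖) ^ 2 := by gcongr
              _ = _ := by ring
          · refine (hk' s τ).trans (le_of_eq ?_)
            push_cast; ring
      _ = _ := by rw [← Finset.sum_mul, sum_trajProb M (softmax_mem ψ _), one_mul]
  have := Convex.norm_image_sub_le_of_norm_hasDerivWithin_le (s := Set.univ) (x := 0) (y := s)
    (fun s _ => (hd s).hasDerivWithinAt) (fun s _ => hb s) convex_univ trivial trivial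
  simpa using this

end Softmax

/-! ### Geometric series -/

section Series

variable {γ : ℝ}

lemma hasSum_geometric_mul_succ (h0 : 0 ≤ γ) (h1 : γ < 1) :
    HasSum (fun h : ℕ => γ ^ h * ((h : ℝ) + 1)) (1 / (1 - γ) ^ 2) := by
  have h2 := hasSum_choose_mul_geometric_of_norm_lt_one 1
    (show ‖γ‖ < 1 by rwa [Real.norm_eq_abs, abs_of_nonneg h0])
  have h3 : (fun h : ℕ => γ ^ h * ((h : ℝ) + 1)) = fun h => ((h + 1).choose 1 : ℝ) * γ ^ h := by
    funext h
    rw [Nat.choose_one_right]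
    push_cast
    ring
  rw [h3]
  exact h2

/-- The weight (h + 1)(h + 2) dominates (h + 1)² and has this simple sum. Its 2, times the 4 in
`norm_occAtDir_sub_le`, gives the 8 in `Lθ`. -/
lemma hasSum_geometric_mul_succ_mul_succ (h0 : 0 ≤ γ) (h1 : γ < 1) :
    HasSum (fun h : ℕ => γ ^ h * (((h : ℝ) + 1) * (h + 2))) (2 / (1 - γ) ^ 3) := by
  have h2 := (hasSum_choose_mul_geometric_of_norm_lt_one 2
    (show ‖γ‖ < 1 by rwa [Real.norm_eq_abs, abs_of_nonneg h0])).mul_left 2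
  rw [mul_one_div] at h2
  have h3 : (fun h : ℕ => γ ^ h * (((h : ℝ) + 1) * (h + 2)))
      = fun h => 2 * (((h + 2).choose 2 : ℝ) * γ ^ h) := by
    funext h
    rw [Nat.cast_choose_two]
    push_cast
    ring
  rw [h3]
  exact h2

end Series

section Occupancy

variable [Nonempty A] {d : ℕ} {ψ : S → A → Param d → ℝ} {lψ Lψ : ℝ}

/-! ### The derivative of the occupancy measure -/

lemma norm_geometric_smul_le {E : Type*} [NormedAddCommGroup E] [NormedSpace ℝ E] (M : MDP S A)
    (h : ℕ) {x : E} {C : ℝ} (hx : ‖x‖ ≤ (h + 1) * C) :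
    ‖M.γ ^ h • x‖ ≤ M.γ ^ h * ((h : ℝ) + 1) * C := by
  rw [norm_smul, Real.norm_eq_abs, abs_of_nonneg (pow_nonneg M.γ_pos.le h), mul_assoc]
  exact mul_le_mul_of_nonneg_left hx (pow_nonneg M.γ_pos.le h)

/-- The derivative of `lam` at `θ` in the direction `u`. -/
def lamDir (M : MDP S A) (ψ : S → A → Param d → ℝ) (θ u : Param d) : SAVec S A :=
  (1 - M.γ) • ∑' h : ℕ, M.γ ^ h • occAtDir M ψ θ u h

lemma summable_occAtDir (M : MDP S A) (hψ : PolicyRegular ψ lψ Lψ) (θ u : Param d) :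
    Summable fun h : ℕ => M.γ ^ h • occAtDir M ψ θ u h :=
  Summable.of_norm_bounded
    ((hasSum_geometric_mul_succ M.γ_pos.le M.γ_lt_one).summable.mul_right (lψ * ‖u‖))
    fun h => norm_geometric_smul_le M h (norm_occAtDir_le M hψ θ u h)

lemma hasDerivAt_lam_line (M : MDP S A) (hψ : PolicyRegular ψ lψ Lψ) (θ u : Param d) (s : ℝ) :
    HasDerivAt (fun s : ℝ => lam M ψ (θ + s • u)) (lamDir M ψ (θ + s • u) u) s := by
  have h0 : (fun s : ℝ => lam M ψ (θ + s • u))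
      = fun s : ℝ => (1 - M.γ) • ∑' h : ℕ, M.γ ^ h • occAt M (softmax ψ (θ + s • u)) h := by
    funext s
    exact occ_eq_tsum M (softmax_mem ψ _)
  rw [h0]
  refine HasDerivAt.fun_const_smul _ ?_
  exact hasDerivAt_tsum
    ((hasSum_geometric_mul_succ M.γ_pos.le M.γ_lt_one).summable.mul_right (lψ * ‖u‖))
    (fun h s => (hasDerivAt_occAt_line M hψ θ u h s).fun_const_smul (M.γ ^ h))
    (fun h s => norm_geometric_smul_le M h (norm_occAtDir_le M hψ _ u h))
    (y₀ := 0) (summable_occAt M (softmax_mem ψ _)) s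

lemma norm_lamDir_le (M : MDP S A) (hψ : PolicyRegular ψ lψ Lψ) (θ u : Param d) :
    ‖lamDir M ψ θ u‖ ≤ lψ / (1 - M.γ) * ‖u‖ := by
  have hβ : 0 < 1 - M.γ := sub_pos.2 M.γ_lt_one
  have h1 := tsum_of_norm_bounded
    ((hasSum_geometric_mul_succ M.γ_pos.le M.γ_lt_one).mul_right (lψ * ‖u‖))
    fun h => norm_geometric_smul_le M h (norm_occAtDir_le M hψ θ u h)
  rw [lamDir, norm_smul, Real.norm_eq_abs, abs_of_pos hβ]
  calc _ ≤ (1 - M.γ) * (1 / (1 - M.γ) ^ 2 * (lψ * ‖u‖)) := by gcongr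
    _ = _ := by field_simp

lemma norm_lamDir_sub_le (M : MDP S A) (hψ : PolicyRegular ψ lψ Lψ) (θ u : Param d) (s : ℝ) :
    ‖lamDir M ψ (θ + s • u) u - lamDir M ψ θ u‖
      ≤ (8 * lψ ^ 2 / (1 - M.γ) ^ 2 + 2 * (Lψ + lψ ^ 2) / (1 - M.γ)) * ‖u‖ ^ 2 * |s| := by
  have hβ : 0 < 1 - M.γ := sub_pos.2 M.γ_lt_one
  have h0 : lamDir M ψ (θ + s • u) u - lamDir M ψ θ u
      = (1 - M.γ) • ∑' h : ℕ, M.γ ^ h • (occAtDir M ψ (θ + s • u) u h - occAtDir M ψ θ u h) := by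
    simp only [lamDir, smul_sub]
    rw [(summable_occAtDir M hψ _ u).tsum_sub (summable_occAtDir M hψ _ u), smul_sub]
  have hs := ((hasSum_geometric_mul_succ_mul_succ M.γ_pos.le M.γ_lt_one).mul_right
    (4 * lψ ^ 2 * ‖u‖ ^ 2 * |s|)).add ((hasSum_geometric_mul_succ M.γ_pos.le M.γ_lt_one).mul_right
    ((2 * Lψ + 2 * lψ ^ 2) * ‖u‖ ^ 2 * |s|))
  have h1 := tsum_of_norm_bounded hs (f := fun h : ℕ =>
      M.γ ^ h • (occAtDir M ψ (θ + s • u) u h - occAtDir M ψ θ u h)) fun h => by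
    rw [norm_smul, Real.norm_eq_abs, abs_of_nonneg (pow_nonneg M.γ_pos.le h)]
    calc _ ≤ M.γ ^ h * ((((h + 1) ^ 2 * (4 * lψ ^ 2) + (h + 1) * (2 * Lψ + 2 * lψ ^ 2))
          * ‖u‖ ^ 2) * |s|) := by
          have := norm_occAtDir_sub_le M hψ θ u h s
          have := pow_nonneg M.γ_pos.le h
          gcongr
      _ ≤ M.γ ^ h * (((((h : ℝ) + 1) * (h + 2)) * (4 * lψ ^ 2)
          + (h + 1) * (2 * Lψ + 2 * lψ ^ 2)) * ‖u‖ ^ 2 * |s|) := by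
          have := pow_nonneg M.γ_pos.le h
          gcongr
          nlinarith
      _ = _ := by ring
  rw [h0, norm_smul, Real.norm_eq_abs, abs_of_pos hβ]
  calc _ ≤ (1 - M.γ) * (2 / (1 - M.γ) ^ 3 * (4 * lψ ^ 2 * ‖u‖ ^ 2 * |s|)
        + 1 / (1 - M.γ) ^ 2 * ((2 * Lψ + 2 * lψ ^ 2) * ‖u‖ ^ 2 * |s|)) := by gcongr
    _ = _ := by field_simp; ring

lemma norm_lam_add_sub_le (M : MDP S A) (hψ : PolicyRegular ψ lψ Lψ) (θ u : Param d) :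
    ‖lam M ψ (θ + u) - lam M ψ θ‖ ≤ lψ / (1 - M.γ) * ‖u‖ := by
  have := Convex.norm_image_sub_le_of_norm_hasDerivWithin_le (s := Set.univ) (x := 0) (y := (1 : ℝ))
    (fun s _ => (hasDerivAt_lam_line M hψ θ u s).hasDerivWithinAt)
    (fun s _ => norm_lamDir_le M hψ _ u) convex_univ trivial trivial
  simpa using this

lemma continuous_lam (M : MDP S A) (hψ : PolicyRegular ψ lψ Lψ) : Continuous (lam M ψ) := by
  have hβ : 0 < 1 - M.γ := sub_pos.2 M.γ_lt_one
  have h : LipschitzWith (lψ / (1 - M.γ)).toNNReal (lam M ψ) := by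
    refine LipschitzWith.of_dist_le_mul fun x y => ?_
    rw [dist_eq_norm, dist_eq_norm, Real.coe_toNNReal _ (div_nonneg hψ.lψ_pos.le hβ.le)]
    simpa using norm_lam_add_sub_le M hψ y (x - y)
  exact h.continuous

lemma norm_lam_le (M : MDP S A) (ψ : S → A → Param d → ℝ) (θ : Param d) : ‖lam M ψ θ‖ ≤ 1 :=
  norm_occ_le M (softmax_mem ψ θ)

/-! ### The policy gradient -/

/-- The gradient at `θ` of the expected reward `r` at time `h`. -/
def rewardGrad (M : MDP S A) (ψ : S → A → Param d → ℝ) (θ : Param d) (r : SAVec S A) (h : ℕ) :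
    Param d :=
  ∑ τ : Fin (h + 1) → S × A,
    (trajProb M (softmax ψ θ) τ * r (τ (Fin.last h))) • trajScore ψ θ τ

lemma abs_apply_le (r : SAVec S A) (x : S × A) : |r x| ≤ ‖r‖ := by
  simpa using PiLp.norm_apply_le r x

lemma norm_rewardGrad_le (M : MDP S A) (hψ : PolicyRegular ψ lψ Lψ) (θ : Param d) (r : SAVec S A)
    (h : ℕ) : ‖rewardGrad M ψ θ r h‖ ≤ (h + 1) * (lψ * ‖r‖) := by
  have h1 := sum_trajProb_mul_norm_trajScore_le M hψ θ (h + 1)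
  refine (norm_sum_le _ _).trans ?_
  calc _ ≤ ∑ τ : Fin (h + 1) → S × A,
        trajProb M (softmax ψ θ) τ * ‖trajScore ψ θ τ‖ * ‖r‖ := by
        refine Finset.sum_le_sum fun τ _ => ?_
        have hp := trajProb_nonneg M (softmax_mem ψ θ) τ
        rw [norm_smul, Real.norm_eq_abs, abs_mul, abs_of_nonneg hp, mul_right_comm]
        exact mul_le_mul_of_nonneg_left (abs_apply_le r _) (by positivity)
    _ ≤ ((h + 1 : ℕ) * lψ) * ‖r‖ := by
        rw [← Finset.sum_mul]
        exact mul_le_mul_of_nonneg_right h1 (norm_nonneg r)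
    _ = _ := by push_cast; ring

/-- Both sides are the expectation of the reward at time `h` times the directional trajectory score:
the two derivatives are adjoint. Summed over `h`, this makes `discGrad` the adjoint of `lamDir`, as
the chain rule for F ∘ λ requires. -/
lemma inner_rewardGrad (M : MDP S A) (ψ : S → A → Param d → ℝ) (θ u : Param d) (r : SAVec S A)
    (h : ℕ) : inner ℝ (rewardGrad M ψ θ r h) u = inner ℝ r (occAtDir M ψ θ u h) := by
  simp only [rewardGrad, occAtDir, sum_inner, inner_sum, real_inner_smul_left,
    real_inner_smul_right, inner_unitVec]
  exact Finset.sum_congr rfl fun τ _ => by ring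

lemma rewardGrad_sub (M : MDP S A) (ψ : S → A → Param d → ℝ) (θ : Param d) (r r' : SAVec S A)
    (h : ℕ) : rewardGrad M ψ θ (r - r') h = rewardGrad M ψ θ r h - rewardGrad M ψ θ r' h := by
  simp only [rewardGrad, PiLp.sub_apply, mul_sub, sub_smul, Finset.sum_sub_distrib]

/-- The gradient at `θ` of the expected discounted reward `r`, normalized by `1 - γ`. -/
def discGrad (M : MDP S A) (ψ : S → A → Param d → ℝ) (θ : Param d) (r : SAVec S A) : Param d :=
  (1 - M.γ) • ∑' h : ℕ, M.γ ^ h • rewardGrad M ψ θ r h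

lemma summable_rewardGrad (M : MDP S A) (hψ : PolicyRegular ψ lψ Lψ) (θ : Param d)
    (r : SAVec S A) : Summable fun h : ℕ => M.γ ^ h • rewardGrad M ψ θ r h :=
  Summable.of_norm_bounded
    ((hasSum_geometric_mul_succ M.γ_pos.le M.γ_lt_one).summable.mul_right (lψ * ‖r‖))
    fun h => norm_geometric_smul_le M h (norm_rewardGrad_le M hψ θ r h)

lemma inner_discGrad (M : MDP S A) (hψ : PolicyRegular ψ lψ Lψ) (θ u : Param d) (r : SAVec S A) :
    inner ℝ (discGrad M ψ θ r) u = inner ℝ r (lamDir M ψ θ u) := by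
  rw [discGrad, lamDir, real_inner_smul_left, real_inner_smul_right, real_inner_comm]
  have h1 := (innerSL ℝ u).map_tsum (summable_rewardGrad M hψ θ r)
  have h2 := (innerSL ℝ r).map_tsum (summable_occAtDir M hψ θ u)
  simp only [innerSL_apply_apply] at h1 h2
  rw [h1, h2]
  simp only [real_inner_smul_right, ← inner_rewardGrad M ψ θ u r, real_inner_comm]

lemma continuous_discGrad (M : MDP S A) (hψ : PolicyRegular ψ lψ Lψ) {r : Param d → SAVec S A}
    (hr : Continuous r) {C : ℝ} (hC : ∀ θ, ‖r θ‖ ≤ C) :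
    Continuous fun θ => discGrad M ψ θ (r θ) := by
  have h1 : Continuous fun θ => ∑' h : ℕ, M.γ ^ h • rewardGrad M ψ θ (r θ) h := by
    refine continuous_tsum (u := fun h : ℕ => M.γ ^ h * ((h : ℝ) + 1) * (lψ * C)) (fun h => ?_)
      ((hasSum_geometric_mul_succ M.γ_pos.le M.γ_lt_one).summable.mul_right (lψ * C)) fun h θ => ?_
    · have h2 : Continuous fun θ => rewardGrad M ψ θ (r θ) h := by
        unfold rewardGrad trajScore
        refine continuous_finsetSum _ fun τ _ => ((continuous_trajProb M hψ τ).mul ?_).smul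
          (continuous_finsetSum _ fun t _ => continuous_score hψ _ _)
        exact (PiLp.continuous_apply 2 (fun _ : S × A => ℝ) (τ (Fin.last h))).comp hr
      exact h2.fun_const_smul (M.γ ^ h)
    · refine norm_geometric_smul_le M h ((norm_rewardGrad_le M hψ θ (r θ) h).trans ?_)
      have := hψ.lψ_pos
      have := hC θ
      gcongr
  exact h1.fun_const_smul (1 - M.γ)

/-! ### The truncated policy gradient estimate -/

/-- Exchanging the two sums, each reward is multiplied by the scores up to its own time, so a new
final reward meets the score of the whole trajectory. This allows induction on the horizon. -/
lemma gEst_succ (M : MDP S A) (ψ : S → A → Param d → ℝ) {H : ℕ} (τ : Fin (H + 1) → S × A)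
    (θ : Param d) (r : SAVec S A) :
    gEst M ψ τ θ r = gEst M ψ (Fin.init (α := fun _ => S × A) τ) θ r
      + (M.γ ^ H * r (τ (Fin.last H))) • trajScore ψ θ τ := by
  have key : ∀ {K : ℕ} (τ : Fin K → S × A), gEst M ψ τ θ r = ∑ t, ∑ h,
      if t ≤ h then (M.γ ^ h.val * r (τ h)) • score ψ θ (τ t).1 (τ t).2 else 0 := by
    intro K τ
    refine Finset.sum_congr rfl fun t _ => ?_
    rw [Finset.sum_smul, ← Finset.sum_filter]
    congr 1
    ext h
    simp
  rw [key, key, trajScore, Fin.sum_univ_castSucc]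
  simp only [Fin.sum_univ_castSucc, Fin.castSucc_le_castSucc_iff, Fin.le_last, if_true,
    Fin.val_castSucc, Fin.val_last, Finset.sum_add_distrib, smul_add, Finset.smul_sum, Fin.init]
  have h0 : ∀ h : Fin H, ¬ Fin.last H ≤ h.castSucc := fun h => not_le.2 (Fin.castSucc_lt_last h)
  simp only [h0, if_false, Finset.sum_const_zero, zero_add]
  abel

lemma norm_gEst_le (M : MDP S A) (hψ : PolicyRegular ψ lψ Lψ) {H : ℕ} (τ : Fin H → S × A)
    (θ : Param d) (r : SAVec S A) : ‖gEst M ψ τ θ r‖ ≤ 2 * lψ * ‖r‖ / (1 - M.γ) ^ 2 := by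
  have hl := hψ.lψ_pos
  have h1 : ‖gEst M ψ τ θ r‖ ≤ ∑ h ∈ Finset.range H, M.γ ^ h * ((h : ℝ) + 1) * (2 * lψ * ‖r‖) := by
    induction H with
    | zero => simp [gEst]
    | succ H ih =>
      rw [gEst_succ, Finset.sum_range_succ]
      refine (norm_add_le _ _).trans (add_le_add (ih _) ?_)
      have h2 := norm_trajScore_le hψ θ τ
      rw [norm_smul, Real.norm_eq_abs, abs_mul, abs_of_nonneg (pow_nonneg M.γ_pos.le H)]
      calc _ ≤ M.γ ^ H * ‖r‖ * ((H + 1 : ℕ) * (2 * lψ)) := by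
            have := pow_nonneg M.γ_pos.le H
            have := abs_apply_le r (τ (Fin.last H))
            gcongr
        _ = _ := by push_cast; ring
  have h2 := (hasSum_geometric_mul_succ M.γ_pos.le M.γ_lt_one).mul_right (2 * lψ * ‖r‖)
  refine h1.trans ((h2.summable.sum_le_tsum _ fun h _ => ?_).trans ?_)
  · have := pow_nonneg M.γ_pos.le h
    positivity
  · rw [h2.tsum_eq]
    exact le_of_eq (by ring)

lemma sum_trajProb_smul_gEst (M : MDP S A) (ψ : S → A → Param d → ℝ) (H : ℕ) (θ : Param d)
    (r : SAVec S A) :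
    ∑ τ : Fin H → S × A, trajProb M (softmax ψ θ) τ • gEst M ψ τ θ r
      = ∑ h ∈ Finset.range H, M.γ ^ h • rewardGrad M ψ θ r h := by
  induction H with
  | zero => simp [gEst]
  | succ H ih =>
    simp only [gEst_succ, smul_add, Finset.sum_add_distrib]
    rw [Finset.sum_range_succ,
      sum_trajProb_init M (softmax_mem ψ θ) (fun τ : Fin H → S × A => gEst M ψ τ θ r), ih]
    congr 1
    rw [rewardGrad, Finset.smul_sum]
    refine Finset.sum_congr rfl fun τ _ => ?_
    rw [smul_smul, smul_smul]
    congr 1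
    ring

/-- The bias has two parts: the reward error `r' - r` in the first `H` terms, and the discarded tail
of the series for `r`. -/
lemma norm_expected_gEst_sub_le (M : MDP S A) (hψ : PolicyRegular ψ lψ Lψ) (H : ℕ) (θ : Param d)
    (r r' : SAVec S A) :
    ‖(∑ τ : Fin H → S × A, trajProb M (softmax ψ θ) τ • (1 - M.γ) • gEst M ψ τ θ r')
        - discGrad M ψ θ r‖
      ≤ lψ / (1 - M.γ) * (‖r' - r‖ + ‖r‖ * ((H + 1) * M.γ ^ H)) := by
  have hβ : 0 < 1 - M.γ := sub_pos.2 M.γ_lt_one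
  have hl := hψ.lψ_pos
  have hγ := fun h : ℕ => pow_nonneg M.γ_pos.le h
  have h0 : (∑ τ : Fin H → S × A, trajProb M (softmax ψ θ) τ • (1 - M.γ) • gEst M ψ τ θ r')
        - discGrad M ψ θ r
      = (1 - M.γ) • ((∑ h ∈ Finset.range H, M.γ ^ h • rewardGrad M ψ θ (r' - r) h)
        - ∑' h : ℕ, M.γ ^ (h + H) • rewardGrad M ψ θ r (h + H)) := by
    simp only [smul_comm _ (1 - M.γ)]
    rw [← Finset.smul_sum, sum_trajProb_smul_gEst, discGrad, ← smul_sub,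
      ← (summable_rewardGrad M hψ θ r).sum_add_tsum_nat_add H]
    simp only [rewardGrad_sub, smul_sub (M.γ ^ _), Finset.sum_sub_distrib]
    congr 1
    abel
  have h1 : ‖∑ h ∈ Finset.range H, M.γ ^ h • rewardGrad M ψ θ (r' - r) h‖
      ≤ 1 / (1 - M.γ) ^ 2 * (lψ * ‖r' - r‖) := by
    have h2 := (hasSum_geometric_mul_succ M.γ_pos.le M.γ_lt_one).mul_right (lψ * ‖r' - r‖)
    refine (norm_sum_le _ _).trans ((Finset.sum_le_sum fun h _ =>
      norm_geometric_smul_le M h (norm_rewardGrad_le M hψ θ (r' - r) h)).trans ?_)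
    rw [← h2.tsum_eq]
    refine h2.summable.sum_le_tsum _ fun h _ => ?_
    have := hγ h
    positivity
  have h2 : ‖∑' h : ℕ, M.γ ^ (h + H) • rewardGrad M ψ θ r (h + H)‖
      ≤ 1 / (1 - M.γ) ^ 2 * (lψ * ‖r‖ * ((H + 1) * M.γ ^ H)) := by
    refine tsum_of_norm_bounded ((hasSum_geometric_mul_succ M.γ_pos.le M.γ_lt_one).mul_right _)
      fun h => ?_
    refine (norm_geometric_smul_le M (h + H) (norm_rewardGrad_le M hψ θ r (h + H))).trans ?_
    -- Separating `h` from `H` reduces the tail to the standard series times `(H + 1) * M.γ ^ H`.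
    have e1 : ((h + H : ℕ) : ℝ) + 1 ≤ (h + 1) * (H + 1) := by
      push_cast
      nlinarith [mul_nonneg (Nat.cast_nonneg (α := ℝ) h) (Nat.cast_nonneg (α := ℝ) H)]
    calc _ ≤ M.γ ^ (h + H) * ((h + 1) * (H + 1)) * (lψ * ‖r‖) := by
          have := hγ (h + H)
          gcongr
      _ = _ := by rw [pow_add]; ring
  rw [h0, norm_smul, Real.norm_eq_abs, abs_of_pos hβ]
  calc _ ≤ (1 - M.γ) * (1 / (1 - M.γ) ^ 2 * (lψ * ‖r' - r‖)
        + 1 / (1 - M.γ) ^ 2 * (lψ * ‖r‖ * ((H + 1) * M.γ ^ H))) := by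
        have := norm_sub_le (∑ h ∈ Finset.range H, M.γ ^ h • rewardGrad M ψ θ (r' - r) h)
          (∑' h : ℕ, M.γ ^ (h + H) • rewardGrad M ψ θ r (h + H))
        gcongr
        linarith
    _ = _ := by field_simp

/-! ### Smoothness of the objective -/

/-- For c = ±1 the function c(φ(s) - s φ'(0)) - C s²/2 is nonincreasing on [0, 1]; comparing its
endpoints gives the two signs. -/
lemma abs_sub_sub_deriv_le {φ φ' : ℝ → ℝ} {C : ℝ} (hφ : ∀ s, HasDerivAt φ (φ' s) s)
    (hC : ∀ s, |φ' s - φ' 0| ≤ C * |s|) : |φ 1 - φ 0 - φ' 0| ≤ C / 2 := by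
  have hd : ∀ c s : ℝ, HasDerivAt (fun s => c * (φ s - s * φ' 0) - C / 2 * s ^ 2)
      (c * (φ' s - φ' 0) - C * s) s := by
    intro c s
    have h1 := (((hφ s).sub ((hasDerivAt_id s).mul_const (φ' 0))).const_mul c).sub
      ((hasDerivAt_pow 2 s).const_mul (C / 2))
    refine h1.congr_deriv ?_
    norm_num
    ring
  have hc : ∀ c : ℝ, |c| = 1 → c * (φ 1 - φ' 0) - C / 2 ≤ c * φ 0 := by
    intro c hc
    have h1 := antitoneOn_of_deriv_nonpos (convex_Icc (0 : ℝ) 1)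
      (fun s _ => (hd c s).continuousAt.continuousWithinAt)
      (fun s _ => (hd c s).differentiableAt.differentiableWithinAt) (fun s hs => by
        rw [interior_Icc] at hs
        rw [(hd c s).deriv]
        have h2 := hC s
        rw [abs_of_pos hs.1] at h2
        have h3 : c * (φ' s - φ' 0) ≤ |φ' s - φ' 0| := by
          refine (le_abs_self _).trans ?_
          rw [abs_mul, hc, one_mul]
        linarith)
    have h2 := h1 (Set.left_mem_Icc.2 zero_le_one) (Set.right_mem_Icc.2 zero_le_one) zero_le_one
    norm_num at h2
    linarith
  have h1 := hc 1 (by norm_num)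
  have h2 := hc (-1) (by norm_num)
  rw [abs_le]
  constructor <;> linarith

lemma Lθ_pos (M : MDP S A) (hψ : PolicyRegular ψ lψ Lψ) {lF LF : ℝ} (hl : 0 < lF) (hL : 0 < LF) :
    0 < Lθ M.γ lψ Lψ lF LF := by
  have hβ : 0 < 1 - M.γ := sub_pos.2 M.γ_lt_one
  have := hψ.lψ_pos
  have := hψ.Lψ_pos
  unfold Lθ
  positivity

/-- The objective is smooth with the constant `(1 - γ) * Lθ`, and `discGrad` gives its gradient. -/
lemma abs_objective_sub_le (M : MDP S A) (hψ : PolicyRegular ψ lψ Lψ) {F : SAVec S A → ℝ}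
    {Λ : Set (SAVec S A)} {lF LF : ℝ} (hF : UtilitySmooth F Λ lF LF) (hΛ : ∀ θ, lam M ψ θ ∈ Λ)
    (θ u : Param d) :
    |F (lam M ψ (θ + u)) - F (lam M ψ θ)
        - inner ℝ (discGrad M ψ θ (gradient F (lam M ψ θ))) u|
      ≤ (1 - M.γ) * Lθ M.γ lψ Lψ lF LF / 2 * ‖u‖ ^ 2 := by
  have hβ : 0 < 1 - M.γ := sub_pos.2 M.γ_lt_one
  have hβ1 : 1 - M.γ ≤ 1 := by linarith [M.γ_pos]
  have hl := hψ.lψ_pos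
  have hL := hψ.Lψ_pos
  have hlF := hF.lF_pos
  have hLF := hF.LF_pos
  have hd : ∀ s : ℝ, HasDerivAt (fun s : ℝ => F (lam M ψ (θ + s • u)))
      (inner ℝ (gradient F (lam M ψ (θ + s • u))) (lamDir M ψ (θ + s • u) u)) s := fun s => by
    have := (hF.differentiableAt _ (hΛ (θ + s • u))).hasGradientAt.hasFDerivAt.comp_hasDerivAt s
      (hasDerivAt_lam_line M hψ θ u s)
    simpa only [Function.comp_def, InnerProductSpace.toDual_apply_apply] using this
  have hk : ∀ s : ℝ,
      |inner ℝ (gradient F (lam M ψ (θ + s • u))) (lamDir M ψ (θ + s • u) u)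
        - inner ℝ (gradient F (lam M ψ (θ + (0 : ℝ) • u))) (lamDir M ψ (θ + (0 : ℝ) • u) u)|
      ≤ (1 - M.γ) * Lθ M.γ lψ Lψ lF LF * ‖u‖ ^ 2 * |s| := by
    intro s
    rw [zero_smul, add_zero]
    set x := lam M ψ (θ + s • u)
    set y := lam M ψ θ
    set x' := lamDir M ψ (θ + s • u) u
    set y' := lamDir M ψ θ u
    have e0 : inner ℝ (gradient F x) x' - inner ℝ (gradient F y) y'
        = inner ℝ (gradient F x - gradient F y) x' + inner ℝ (gradient F y) (x' - y') := by
      rw [inner_sub_left, inner_sub_right]; ring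
    have e1 : ‖gradient F x - gradient F y‖ ≤ LF * (lψ / (1 - M.γ) * (|s| * ‖u‖)) := by
      refine (hF.grad_lipschitz x (hΛ _) y (hΛ _)).trans (mul_le_mul_of_nonneg_left ?_ hLF.le)
      have := norm_lam_add_sub_le M hψ θ (s • u)
      rwa [norm_smul, Real.norm_eq_abs] at this
    have e2 : |inner ℝ (gradient F x - gradient F y) x'|
        ≤ LF * (lψ / (1 - M.γ) * (|s| * ‖u‖)) * (lψ / (1 - M.γ) * ‖u‖) :=
      (abs_real_inner_le_norm _ _).trans
        (mul_le_mul e1 (norm_lamDir_le M hψ _ u) (norm_nonneg _) ((norm_nonneg _).trans e1))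
    have e3 : |inner ℝ (gradient F y) (x' - y')| ≤ lF *
        ((8 * lψ ^ 2 / (1 - M.γ) ^ 2 + 2 * (Lψ + lψ ^ 2) / (1 - M.γ)) * ‖u‖ ^ 2 * |s|) :=
      (abs_real_inner_le_norm _ _).trans (mul_le_mul (hF.grad_le y (hΛ _))
        (norm_lamDir_sub_le M hψ θ u s) (norm_nonneg _) hlF.le)
    rw [e0]
    refine (abs_add_le _ _).trans ((add_le_add e2 e3).trans ?_)
    -- The first term of `Lθ` is larger than needed, by a factor 4 and a power of 1 / (1 - γ).
    have e4 : LF * lψ ^ 2 / (1 - M.γ) ^ 2 ≤ 4 * LF * lψ ^ 2 / (1 - M.γ) ^ 3 := by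
      rw [div_le_div_iff₀ (by positivity) (by positivity)]
      have : (1 - M.γ) ^ 3 ≤ (1 - M.γ) ^ 2 := pow_le_pow_of_le_one hβ.le hβ1 (by norm_num)
      have h5 : 0 < LF * lψ ^ 2 := by positivity
      nlinarith [mul_le_mul_of_nonneg_left this h5.le, mul_pos h5 (pow_pos hβ 2)]
    calc _ = (LF * lψ ^ 2 / (1 - M.γ) ^ 2 + lF * (8 * lψ ^ 2 / (1 - M.γ) ^ 2
            + 2 * (Lψ + lψ ^ 2) / (1 - M.γ))) * (‖u‖ ^ 2 * |s|) := by
          field_simp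
      _ ≤ (4 * LF * lψ ^ 2 / (1 - M.γ) ^ 3 + lF * (8 * lψ ^ 2 / (1 - M.γ) ^ 2
            + 2 * (Lψ + lψ ^ 2) / (1 - M.γ))) * (‖u‖ ^ 2 * |s|) := by gcongr
      _ = _ := by
          unfold Lθ
          field_simp
          ring
  have := abs_sub_sub_deriv_le hd hk
  simp only [one_smul, zero_smul, add_zero, ← inner_discGrad M hψ] at this
  refine this.trans (le_of_eq (by ring))

end Occupancy

section Convergence

variable [Nonempty A] {d : ℕ} {ψ : S → A → Param d → ℝ} {lψ Lψ lF LF : ℝ} {F : SAVec S A → ℝ}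
  {Λ : Set (SAVec S A)}

/-! ### Consequences of overparametrization -/

/-- The lift is the local inverse at the segment point. As this inverse sends `lam M ψ θ` back to
`θ`, its Lipschitz constant controls the displacement. -/
lemma Overparametrized.exists_lift {M : MDP S A} {Θ : Set (Param d)} {θstar : Param d} {l : ℝ≥0}
    {ηbar : ℝ} (hover : Overparametrized M ψ Λ Θ θstar l ηbar) {θ : Param d} (hθ : θ ∈ Θ) {η : ℝ}
    (hη : 0 < η) (hη_le : η ≤ ηbar) :
    ∃ θ', lam M ψ θ' = (1 - η) • lam M ψ θ + η • lam M ψ θstar ∧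
      ‖θ' - θ‖ ≤ l * (η * ‖lam M ψ θstar - lam M ψ θ‖) := by
  obtain ⟨U, V, h1, h2, h3⟩ := hover
  obtain ⟨hU, hV, -, hbij⟩ := h1 θ hθ
  have hz := h3 θ hθ η hη hη_le
  have hinv := hbij.invOn_invFunOn
  refine ⟨_, hinv.2 hz, ?_⟩
  have h4 := (h2 θ hθ).dist_le_mul _ hz _ hV
  rw [hinv.1 hU, dist_eq_norm, dist_eq_norm] at h4
  have h5 : (1 - η) • lam M ψ θ + η • lam M ψ θstar - lam M ψ θ
      = η • (lam M ψ θstar - lam M ψ θ) := by module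
  rwa [h5, norm_smul, Real.norm_eq_abs, abs_of_pos hη] at h4

lemma lamDir_neg (M : MDP S A) (ψ : S → A → Param d → ℝ) (θ u : Param d) :
    lamDir M ψ θ (-u) = -lamDir M ψ θ u := by
  simp only [lamDir, occAtDir, inner_neg_right, mul_neg, neg_smul, Finset.sum_neg_distrib,
    smul_neg, tsum_neg]

lemma norm_lam_add_sub_sub_lamDir_le (M : MDP S A) (hψ : PolicyRegular ψ lψ Lψ)
    (θ u : Param d) :
    ‖lam M ψ (θ + u) - lam M ψ θ - lamDir M ψ θ u‖
      ≤ (8 * lψ ^ 2 / (1 - M.γ) ^ 2 + 2 * (Lψ + lψ ^ 2) / (1 - M.γ)) * ‖u‖ ^ 2 := by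
  have hβ : 0 < 1 - M.γ := sub_pos.2 M.γ_lt_one
  have hl := hψ.lψ_pos
  have hL := hψ.Lψ_pos
  have hd : ∀ s : ℝ, HasDerivAt (fun s : ℝ => lam M ψ (θ + s • u) - s • lamDir M ψ θ u)
      (lamDir M ψ (θ + s • u) u - lamDir M ψ θ u) s := fun s => by
    simpa using (hasDerivAt_lam_line M hψ θ u s).fun_sub
      ((hasDerivAt_id s).smul_const (lamDir M ψ θ u))
  have := Convex.norm_image_sub_le_of_norm_hasDerivWithin_le (s := Set.Icc (0 : ℝ) 1) (x := 0)
    (y := (1 : ℝ)) (fun s _ => (hd s).hasDerivWithinAt)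
    (fun s hs => (norm_lamDir_sub_le M hψ θ u s).trans (mul_le_of_le_one_right (by positivity)
      (by rw [abs_of_nonneg hs.1]; exact hs.2)))
    (convex_Icc 0 1) (Set.left_mem_Icc.2 zero_le_one) (Set.right_mem_Icc.2 zero_le_one)
  simpa [sub_right_comm] using this

/-- Under global overparametrization the occupancy measure does not depend on the parameter: moving
away from the lifts would otherwise increase the distance to `lam θstar` without bound. -/
lemma Overparametrized.lam_eq {M : MDP S A} (hψ : PolicyRegular ψ lψ Lψ) {θstar : Param d}
    {l : ℝ≥0} (hl : 0 < l) {ηbar : ℝ} (hηbar : 0 < ηbar)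
    (hover : Overparametrized M ψ Λ Set.univ θstar l ηbar) (θ : Param d) :
    lam M ψ θ = lam M ψ θstar := by
  have hβ : 0 < 1 - M.γ := sub_pos.2 M.γ_lt_one
  have hlψ := hψ.lψ_pos
  have hLψ := hψ.Lψ_pos
  set C := 8 * lψ ^ 2 / (1 - M.γ) ^ 2 + 2 * (Lψ + lψ ^ 2) / (1 - M.γ) with hC
  have hC0 : 0 < C := by positivity
  have hl0 : (0 : ℝ) < l := hl
  set f : Param d → ℝ := fun x => ‖lam M ψ θstar - lam M ψ x‖ with hf
  have hf2 : ∀ x, f x ≤ 2 := fun x => (norm_sub_le _ _).trans (by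
    linarith [norm_lam_le M ψ θstar, norm_lam_le M ψ x])
  have hf0 : ∀ x, 0 ≤ f x := fun x => norm_nonneg _
  have hbdd : BddAbove (Set.range f) := ⟨2, by rintro _ ⟨x, rfl⟩; exact hf2 x⟩
  -- Small enough that the two second-order remainders below cost at most half of the gain `η *
  -- ‖v‖`.
  set η := min ηbar (1 / (8 * C * l ^ 2)) with hη
  have hη0 : 0 < η := lt_min hηbar (by positivity)
  have hηC : C * l ^ 2 * η ≤ 1 / 8 := by
    have h1 : η ≤ 1 / (8 * C * l ^ 2) := min_le_right _ _
    rw [le_div_iff₀ (by positivity)] at h1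
    linarith
  have hstep : ∀ x, (1 + η / 2) * f x ≤ ⨆ y, f y := by
    intro x
    obtain ⟨x', hx', hd⟩ := hover.exists_lift (Set.mem_univ x) hη0 (min_le_left _ _)
    set w := x' - x with hw
    have h1 := norm_lam_add_sub_sub_lamDir_le M hψ x w
    have h2 := norm_lam_add_sub_sub_lamDir_le M hψ x (-w)
    rw [norm_neg, lamDir_neg, ← hC] at h2
    rw [← hC, hw, add_sub_cancel, ← hw, hx'] at h1
    set v := lam M ψ θstar - lam M ψ x with hv
    -- Adding the expansions at `x + w` and `x - w` cancels the linear terms: up to remainders, `x -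
    -- w` is at distance (1 + η)‖v‖ from the target. In `h6`, one factor ‖v‖ ≤ 2 makes the remainder
    -- linear in ‖v‖.
    have h3 : (1 + η) • v = (lam M ψ θstar - lam M ψ (x + -w))
        + ((1 - η) • lam M ψ x + η • lam M ψ θstar - lam M ψ x - lamDir M ψ x w)
        + (lam M ψ (x + -w) - lam M ψ x - -lamDir M ψ x w) := by
      rw [hv]; module
    have h4 : (1 + η) * ‖v‖ ≤ f (x + -w) + C * ‖w‖ ^ 2 + C * ‖w‖ ^ 2 := by
      have h5 : ‖(1 + η) • v‖ = (1 + η) * ‖v‖ := by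
        rw [norm_smul, Real.norm_eq_abs, abs_of_pos (by linarith)]
      rw [← h5, h3]
      exact (norm_add₃_le).trans (add_le_add_three le_rfl h1 h2)
    have h6 : C * ‖w‖ ^ 2 ≤ η / 4 * ‖v‖ := by
      have h7 : ‖w‖ ^ 2 ≤ (l * (η * ‖v‖)) ^ 2 := by gcongr
      calc C * ‖w‖ ^ 2 ≤ C * (l * (η * ‖v‖)) ^ 2 := by gcongr
        _ = C * l ^ 2 * η * (η * ‖v‖) * ‖v‖ := by ring
        _ ≤ 1 / 8 * (η * ‖v‖) * 2 := by
            have := hf2 x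
            gcongr
        _ = _ := by ring
    have h8 : f (x + -w) ≤ ⨆ y, f y := le_ciSup hbdd _
    change (1 + η / 2) * ‖v‖ ≤ _
    linarith
  -- A finite supremum that still bounds 1 + η/2 times itself cannot be positive.
  have hsup : (⨆ y, f y) ≤ (⨆ y, f y) / (1 + η / 2) := ciSup_le fun x => by
    rw [le_div_iff₀ (by positivity), mul_comm]
    exact hstep x
  have h9 : f θ ≤ ⨆ y, f y := le_ciSup hbdd _
  rw [le_div_iff₀ (by positivity)] at hsup
  have h10 : f θ ≤ 0 := by nlinarith [hf0 θ]
  have h11 : lam M ψ θstar - lam M ψ θ = 0 := norm_le_zero_iff.1 h10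
  exact (sub_eq_zero.1 h11).symm

/-! ### One step of inexact gradient ascent -/

/-- With e = q - D and Δ = a z, half of a‖q - e - z‖² ≥ 0 absorbs all the cross terms, and the
step-size condition leaves the ‖q‖² terms nonnegative. The factor 1/2 would do in place of 3/2 and
5/4; 5/4 is the one that yields the 5 in `C₄`. -/
lemma inexact_ascent {E : Type*} [NormedAddCommGroup E] [InnerProductSpace ℝ E] (D q Δ : E)
    {a L J₀ J₁ Jt : ℝ} (ha : 0 < a) (haL : a * L ≤ 1 / 2)
    (h1 : J₀ + inner ℝ D (a • q) - L / 2 * ‖a • q‖ ^ 2 ≤ J₁)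
    (h2 : Jt ≤ J₀ + inner ℝ D Δ + L / 2 * ‖Δ‖ ^ 2) :
    Jt - (L / 2 + 3 / (2 * a)) * ‖Δ‖ ^ 2 - 5 / 4 * a * ‖q - D‖ ^ 2 ≤ J₁ := by
  obtain ⟨e, rfl⟩ : ∃ e, D = q - e := ⟨q - D, by abel⟩
  obtain ⟨z, rfl⟩ : ∃ z, Δ = a • z := ⟨a⁻¹ • Δ, by rw [smul_smul, mul_inv_cancel₀ ha.ne', one_smul]⟩
  have h3 : 0 ≤ ‖q - e - z‖ ^ 2 := sq_nonneg _
  rw [norm_sub_sq_real, norm_sub_sq_real, inner_sub_left] at h3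
  simp only [inner_sub_left, real_inner_smul_right, norm_smul, Real.norm_eq_abs, mul_pow, sq_abs,
    sub_sub_cancel, real_inner_self_eq_norm_sq, real_inner_comm q e] at *
  have h4 : L / 2 * (a ^ 2 * ‖q‖ ^ 2) ≤ a / 4 * ‖q‖ ^ 2 := by
    have := mul_le_mul_of_nonneg_right haL (mul_nonneg ha.le (sq_nonneg ‖q‖))
    linarith
  have h5 : 3 / (2 * a) * (a ^ 2 * ‖z‖ ^ 2) = 3 / 2 * (a * ‖z‖ ^ 2) := by field_simp
  have h6 := mul_nonneg ha.le h3
  have h7 := mul_nonneg ha.le (sq_nonneg ‖q‖)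
  have h8 := mul_nonneg ha.le (sq_nonneg ‖e‖)
  have h9 := mul_nonneg ha.le (sq_nonneg ‖z‖)
  rw [add_mul, h5]
  nlinarith

/-! ### Expectations given a conditional law -/

lemma integrable_of_bounded {Ω : Type*} [MeasurableSpace Ω] {μ : Measure Ω} [IsFiniteMeasure μ]
    {f : Ω → ℝ} (hf : Measurable f) {C : ℝ} (hC : ∀ ω, |f ω| ≤ C) : Integrable f μ :=
  Integrable.of_bound hf.aestronglyMeasurable C (Filter.Eventually.of_forall hC)

-- Decompose over the finitely many values of `Y` and pull the `m`-measurable factor `Φ x` out of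
-- the conditional expectation of each indicator.
open scoped Classical in
lemma integral_eq_of_condLaw {Ω X : Type*} [Fintype X] {m mΩ : MeasurableSpace Ω} {μ : Measure Ω}
    [IsProbabilityMeasure μ] (hm : m ≤ mΩ) {Y : Ω → X} (hY : ∀ x, MeasurableSet {ω | Y ω = x})
    {p : X → Ω → ℝ}
    (hp : ∀ x, μ[Set.indicator {ω | Y ω = x} (fun _ => (1 : ℝ)) | m] =ᵐ[μ] p x)
    {Φ : X → Ω → ℝ} (hΦ : ∀ x, Measurable[m] (Φ x)) {C : ℝ} (hC : ∀ x ω, |Φ x ω| ≤ C) :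
    Integrable (fun ω => Φ (Y ω) ω) μ ∧ Integrable (fun ω => ∑ x, p x ω * Φ x ω) μ ∧
      ∫ ω, Φ (Y ω) ω ∂μ = ∫ ω, ∑ x, p x ω * Φ x ω ∂μ := by
  set I : X → Ω → ℝ := fun x => Set.indicator {ω | Y ω = x} (fun _ => (1 : ℝ)) with hI
  have hIm : ∀ x, Measurable (I x) := fun x => measurable_const.indicator (hY x)
  have hIi : ∀ x, Integrable (I x) μ := fun x =>
    (integrable_const (1 : ℝ)).indicator (hY x)
  have hIΦ : ∀ x, Integrable (I x * Φ x) μ := fun x => by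
    refine integrable_of_bounded (C := C) ((hIm x).mul ((hΦ x).mono hm le_rfl)) fun ω => ?_
    rw [Pi.mul_apply, abs_mul]
    by_cases h : Y ω = x
    · simpa [hI, h] using hC x ω
    · simpa [hI, h] using (abs_nonneg _).trans (hC x ω)
  have hsum : (fun ω => Φ (Y ω) ω) = fun ω => ∑ x, (I x * Φ x) ω := by
    funext ω
    simp [hI, Set.indicator_apply]
  have hce : ∀ x, μ[I x * Φ x | m] =ᵐ[μ] fun ω => p x ω * Φ x ω := fun x => by
    filter_upwards [condExp_mul_of_stronglyMeasurable_right (hΦ x).stronglyMeasurable (hIΦ x)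
      (hIi x), hp x] with ω h1 h2
    rw [h1, Pi.mul_apply, h2]
  -- No measurability of `p x` is assumed; integrability comes from the almost sure equality with a
  -- conditional expectation.
  have hpΦ : ∀ x, Integrable (fun ω => p x ω * Φ x ω) μ := fun x =>
    integrable_condExp.congr (hce x)
  refine ⟨?_, integrable_finsetSum _ fun x _ => hpΦ x, ?_⟩
  · rw [hsum]
    exact integrable_finsetSum _ fun x _ => hIΦ x
  · rw [hsum, integral_finsetSum _ fun x _ => hIΦ x, integral_finsetSum _ fun x _ => hpΦ x]
    refine Finset.sum_congr rfl fun x _ => ?_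
    rw [← integral_condExp hm]
    exact integral_congr_ae (hce x)

/-! ### The utility along the iterates -/

lemma UtilitySmooth.abs_sub_le (hF : UtilitySmooth F Λ lF LF) (hΛ : Convex ℝ Λ) {x y : SAVec S A}
    (hx : x ∈ Λ) (hy : y ∈ Λ) : |F y - F x| ≤ lF * ‖y - x‖ := by
  refine hΛ.norm_image_sub_le_of_norm_fderiv_le hF.differentiableAt (fun z hz => ?_) hx hy
  have := hF.grad_le z hz
  rwa [gradient, LinearIsometryEquiv.norm_map] at this

/-- The gradient is controlled only on Λ. A continuous extension to the whole space makes its values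
at the random points of Λ measurable. -/
lemma UtilitySmooth.exists_continuous_gradient (hF : UtilitySmooth F Λ lF LF) :
    ∃ G : SAVec S A → SAVec S A, Continuous G ∧ ∀ x ∈ Λ, gradient F x = G x := by
  have h : LipschitzOnWith LF.toNNReal (gradient F) Λ := LipschitzOnWith.of_dist_le_mul
    fun x hx y hy => by
      rw [dist_eq_norm, dist_eq_norm, Real.coe_toNNReal _ hF.LF_pos.le]
      exact hF.grad_lipschitz x hx y hy
  obtain ⟨G, hG, hFG⟩ := h.extend_finite_dimension
  exact ⟨G, hG.continuous, hFG⟩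

lemma norm_discGrad_le (M : MDP S A) (hψ : PolicyRegular ψ lψ Lψ) (θ : Param d) (r : SAVec S A) :
    ‖discGrad M ψ θ r‖ ≤ lψ / (1 - M.γ) * ‖r‖ := by
  -- With horizon 0 the estimate is zero, so its bias is `discGrad` itself.
  have h1 := norm_expected_gEst_sub_le M hψ 0 θ r r
  simpa [gEst] using h1

/-- The error of the gradient estimate from the trajectories `x`, for the reward `r'` instead of
`r`. -/
def gradError (M : MDP S A) (ψ : S → A → Param d → ℝ) {N H : ℕ} (x : Fin N → Fin H → S × A)
    (θ : Param d) (r' r : SAVec S A) : Param d :=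
  (1 / (N : ℝ)) • ∑ i, (1 - M.γ) • gEst M ψ (x i) θ r' - discGrad M ψ θ r

lemma norm_smul_gEst_le (M : MDP S A) (hψ : PolicyRegular ψ lψ Lψ) {H : ℕ} (τ : Fin H → S × A)
    (θ : Param d) {r : SAVec S A} (hr : ‖r‖ ≤ lF) :
    ‖(1 - M.γ) • gEst M ψ τ θ r‖ ≤ 2 * lψ * lF / (1 - M.γ) := by
  have hβ : 0 < 1 - M.γ := sub_pos.2 M.γ_lt_one
  have hl := hψ.lψ_pos
  rw [norm_smul, Real.norm_eq_abs, abs_of_pos hβ]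
  calc _ ≤ (1 - M.γ) * (2 * lψ * lF / (1 - M.γ) ^ 2) := by
        refine mul_le_mul_of_nonneg_left ((norm_gEst_le M hψ τ θ r).trans ?_) hβ.le
        gcongr
    _ = _ := by field_simp

lemma norm_gradError_le (M : MDP S A) (hψ : PolicyRegular ψ lψ Lψ) {N H : ℕ} (hN : 1 ≤ N)
    (x : Fin N → Fin H → S × A) (θ : Param d) {r' r : SAVec S A} (hr' : ‖r'‖ ≤ lF)
    (hr : ‖r‖ ≤ lF) : ‖gradError M ψ x θ r' r‖ ≤ 3 * lψ * lF / (1 - M.γ) := by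
  have hβ : 0 < 1 - M.γ := sub_pos.2 M.γ_lt_one
  have hl := hψ.lψ_pos
  have hN0 : (0 : ℝ) < N := by exact_mod_cast hN
  have h1 : ‖∑ i, (1 - M.γ) • gEst M ψ (x i) θ r'‖ ≤ N * (2 * lψ * lF / (1 - M.γ)) := by
    refine (norm_sum_le _ _).trans ((Finset.sum_le_sum fun i _ =>
      norm_smul_gEst_le M hψ (x i) θ hr').trans ?_)
    simp
  have h2 : ‖discGrad M ψ θ r‖ ≤ lψ / (1 - M.γ) * lF :=
    (norm_discGrad_le M hψ θ r).trans (mul_le_mul_of_nonneg_left hr (by positivity))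
  refine (norm_sub_le _ _).trans ?_
  rw [norm_smul, Real.norm_eq_abs, abs_of_pos (by positivity)]
  calc _ ≤ 1 / (N : ℝ) * (N * (2 * lψ * lF / (1 - M.γ))) + lψ / (1 - M.γ) * lF := by gcongr
    _ = _ := by field_simp; ring

lemma continuous_gradError (M : MDP S A) (hψ : PolicyRegular ψ lψ Lψ) {N H : ℕ}
    (x : Fin N → Fin H → S × A) {r : Param d → SAVec S A} (hr : Continuous r)
    (hr_le : ∀ θ, ‖r θ‖ ≤ lF) :
    Continuous fun z : Param d × SAVec S A => gradError M ψ x z.1 z.2 (r z.1) := by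
  have h1 : ∀ i, Continuous fun z : Param d × SAVec S A => gEst M ψ (x i) z.1 z.2 := fun i => by
    unfold gEst
    refine continuous_finsetSum _ fun t _ => Continuous.fun_smul
      (continuous_finsetSum _ fun h _ => continuous_const.mul ?_)
      ((continuous_score hψ _ _).comp continuous_fst)
    exact (PiLp.continuous_apply 2 (fun _ : S × A => ℝ) (x i h)).comp continuous_snd
  have h2 : Continuous fun z : Param d × SAVec S A => ∑ i, (1 - M.γ) • gEst M ψ (x i) z.1 z.2 :=
    continuous_finsetSum _ fun i _ => (h1 i).fun_const_smul (1 - M.γ)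
  exact (h2.fun_const_smul (1 / (N : ℝ))).sub
    ((continuous_discGrad M hψ hr hr_le).comp continuous_fst)

/-- The mean square error of the gradient estimate: variance and squared bias. -/
lemma sum_gradError_sq_le (M : MDP S A) (hψ : PolicyRegular ψ lψ Lψ) {N : ℕ} (H : ℕ)
    (hN : 1 ≤ N) (θ : Param d) {r' r : SAVec S A} (hr' : ‖r'‖ ≤ lF) (hr : ‖r‖ ≤ lF) {δ : ℝ}
    (hδ : ‖r' - r‖ ≤ LF * δ) :
    ∑ x : Fin N → Fin H → S × A, (∏ i, trajProb M (softmax ψ θ) (x i))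
        * ‖gradError M ψ x θ r' r‖ ^ 2
      ≤ 4 * (lψ ^ 2 * max (lF ^ 2) (LF ^ 2)) / (1 - M.γ) ^ 2
        * (1 / (N : ℝ) + δ ^ 2 + ((H : ℝ) + 1) ^ 2 * M.γ ^ (2 * H)) := by
  have hβ : 0 < 1 - M.γ := sub_pos.2 M.γ_lt_one
  have hl := hψ.lψ_pos
  have hN0 : (0 : ℝ) < N := by exact_mod_cast hN
  have h1 := sum_prod_norm_average_sub_sq_le (trajProb M (softmax ψ θ) (H := H))
    (trajProb_nonneg M (softmax_mem ψ θ)) (sum_trajProb M (softmax_mem ψ θ) H)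
    (fun τ => (1 - M.γ) • gEst M ψ τ θ r') _ (fun τ => norm_smul_gEst_le M hψ τ θ hr') hN
    (discGrad M ψ θ r)
  have h2 : ‖(∑ τ : Fin H → S × A, trajProb M (softmax ψ θ) τ • (1 - M.γ) • gEst M ψ τ θ r')
        - discGrad M ψ θ r‖ ≤ lψ / (1 - M.γ) * (LF * δ + lF * ((H + 1) * M.γ ^ H)) := by
    refine (norm_expected_gEst_sub_le M hψ H θ r r').trans ?_
    have := pow_nonneg M.γ_pos.le H
    gcongr
  refine h1.trans ((add_le_add le_rfl (pow_le_pow_left₀ (norm_nonneg _) h2 2)).trans ?_)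
  set B := max (lF ^ 2) (LF ^ 2)
  have hB1 : lF ^ 2 ≤ B := le_max_left _ _
  have hB2 : LF ^ 2 ≤ B := le_max_right _ _
  have hB0 : 0 ≤ B := (sq_nonneg _).trans hB1
  set y := ((H : ℝ) + 1) * M.γ ^ H with hy
  have hy2 : ((H : ℝ) + 1) ^ 2 * M.γ ^ (2 * H) = y ^ 2 := by rw [hy, mul_pow, pow_mul']
  rw [hy2]
  -- The constant 2 would suffice; 4 matches the variance term, which carries the square of the
  -- pointwise score bound 2 lψ.
  have h3 : (LF * δ + lF * y) ^ 2 ≤ 4 * B * (δ ^ 2 + y ^ 2) := by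
    nlinarith [sq_nonneg (LF * δ - lF * y), mul_le_mul_of_nonneg_right hB2 (sq_nonneg δ),
      mul_le_mul_of_nonneg_right hB1 (sq_nonneg y), mul_nonneg hB0 (sq_nonneg δ),
      mul_nonneg hB0 (sq_nonneg y)]
  calc (2 * lψ * lF / (1 - M.γ)) ^ 2 / N + (lψ / (1 - M.γ) * (LF * δ + lF * y)) ^ 2
      = lψ ^ 2 / (1 - M.γ) ^ 2 * (4 * lF ^ 2 * (1 / N) + (LF * δ + lF * y) ^ 2) := by
        field_simp; ring
    _ ≤ lψ ^ 2 / (1 - M.γ) ^ 2 * (4 * B * (1 / N) + 4 * B * (δ ^ 2 + y ^ 2)) := by gcongr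
    _ = _ := by ring

end Convergence

/-! ### Expected progress along the run -/

section Main

variable [Nonempty A] {d : ℕ} {ψ : S → A → Param d → ℝ} {lψ Lψ lF LF : ℝ} {F : SAVec S A → ℝ}
  {Λ : Set (SAVec S A)} {M : MDP S A} {m : ℕ} {W : Set (Fin m → ℝ)} {p : (Fin m → ℝ) → S → ℝ}
  {Ω : Type*} [mΩ : MeasurableSpace Ω] {μ : Measure Ω} {T N H n : ℕ} {α : ℝ}

/-- The error of the gradient estimate at iteration `t`. -/
def Run.gradError (R : Run M ψ F W p μ T N H n α) (t : ℕ) (ω : Ω) : Param d :=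
  RLGU.gradError M ψ (R.traj t ω) (R.θ t ω) (gradient F (R.lamHat t ω))
    (gradient F (lam M ψ (R.θ t ω)))

lemma continuous_objective (hψ : PolicyRegular ψ lψ Lψ) (hF : UtilitySmooth F Λ lF LF)
    (hΛ : ∀ θ, lam M ψ θ ∈ Λ) : Continuous fun θ => F (lam M ψ θ) :=
  continuous_iff_continuousAt.2 fun θ =>
    (hF.differentiableAt _ (hΛ θ)).continuousAt.comp (continuous_lam M hψ).continuousAt

lemma Run.measurable_θ' (R : Run M ψ F W p μ T N H n α) {t : ℕ} (ht : t ≤ T) :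
    Measurable (R.θ t) := (R.measurable_θ t ht).mono (R.past_le t) le_rfl

lemma Run.integrable_gap [IsProbabilityMeasure μ] (R : Run M ψ F W p μ T N H n α)
    (hψ : PolicyRegular ψ lψ Lψ) (hF : UtilitySmooth F Λ lF LF) (hconv : Convex ℝ Λ)
    (hΛ : ∀ θ, lam M ψ θ ∈ Λ) (θstar : Param d) {t : ℕ} (ht : t ≤ T) :
    Integrable (fun ω => F (lam M ψ θstar) - F (lam M ψ (R.θ t ω))) μ := by
  refine integrable_of_bounded (C := lF * 2) ((continuous_const.sub
    (continuous_objective hψ hF hΛ)).measurable.comp (R.measurable_θ' ht)) fun ω => ?_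
  refine (hF.abs_sub_le hconv (hΛ _) (hΛ _)).trans (mul_le_mul_of_nonneg_left ?_ hF.lF_pos.le)
  refine (norm_sub_le _ _).trans ?_
  linarith [norm_lam_le M ψ θstar, norm_lam_le M ψ (R.θ t ω)]

/-- The decrease of the optimality gap along one update. -/
lemma Run.gap_succ_le (R : Run M ψ F W p μ T N H n α) (hψ : PolicyRegular ψ lψ Lψ)
    (hF : UtilitySmooth F Λ lF LF) (hconc : ConcaveOn ℝ Λ F) (hΛ : ∀ θ, lam M ψ θ ∈ Λ)
    {Θ : Set (Param d)} {θstar : Param d} {l : ℝ≥0} {ηbar : ℝ}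
    (hover : Overparametrized M ψ Λ Θ θstar l ηbar) (hα : 0 < α)
    (hαL : α ≤ 1 / (2 * Lθ M.γ lψ Lψ lF LF)) {η : ℝ} (hη : 0 < η) (hη_lt : η < ηbar)
    (hη_le : η ≤ 1) {t : ℕ} (ht : t < T) {ω : Ω} (hω : R.θ t ω ∈ Θ) :
    F (lam M ψ θstar) - F (lam M ψ (R.θ (t + 1) ω))
      ≤ (1 - η) * (F (lam M ψ θstar) - F (lam M ψ (R.θ t ω)))
        + ((1 - M.γ) * Lθ M.γ lψ Lψ lF LF / 2 + 3 / (2 * (α / (1 - M.γ)))) * (4 * l ^ 2 * η ^ 2)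
        + 5 / 4 * (α / (1 - M.γ)) * ‖R.gradError t ω‖ ^ 2 := by
  have hβ : 0 < 1 - M.γ := sub_pos.2 M.γ_lt_one
  have hLθ := Lθ_pos M hψ hF.lF_pos hF.LF_pos
  set θ := R.θ t ω with hθ
  set J := fun θ => F (lam M ψ θ) with hJ
  set D := discGrad M ψ θ (gradient F (lam M ψ θ)) with hD
  set q := (1 / (N : ℝ)) • ∑ i, (1 - M.γ) • gEst M ψ (R.traj t ω i) θ
    (gradient F (R.lamHat t ω)) with hq
  -- λ carries the factor 1 - γ, while `gEst` estimates an unnormalized gradient. A step α along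
  -- `gEst` is a step α / (1 - γ) along the normalized one, and the product of step and smoothness
  -- constant is still α L_θ.
  have hstep : R.θ (t + 1) ω = θ + (α / (1 - M.γ)) • q := by
    rw [R.update t ht ω, hq, ← Finset.smul_sum, smul_smul, smul_smul]
    congr 2
    field_simp
  obtain ⟨θ', hθ', hd⟩ := hover.exists_lift hω hη hη_lt.le
  have h1 := (abs_le.1 (abs_objective_sub_le M hψ hF hΛ θ ((α / (1 - M.γ)) • q))).1
  have h2 := (abs_le.1 (abs_objective_sub_le M hψ hF hΛ θ (θ' - θ))).2
  rw [← hstep] at h1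
  rw [add_sub_cancel] at h2
  have h3 := inexact_ascent D q (θ' - θ) (a := α / (1 - M.γ))
    (L := (1 - M.γ) * Lθ M.γ lψ Lψ lF LF) (J₀ := J θ) (J₁ := J (R.θ (t + 1) ω)) (Jt := J θ')
    (by positivity) (by
      rw [le_div_iff₀ (by positivity)] at hαL
      have : α / (1 - M.γ) * ((1 - M.γ) * Lθ M.γ lψ Lψ lF LF) = α * Lθ M.γ lψ Lψ lF LF := by
        field_simp
      rw [this]
      linarith) (by linarith) (by linarith)
  -- Here concavity of F in λ replaces concavity of J in θ.
  have h4 : (1 - η) * J θ + η * J θstar ≤ J θ' := by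
    have := hconc.2 (hΛ θ) (hΛ θstar) (sub_nonneg.2 hη_le) hη.le (by ring)
    rw [← hθ'] at this
    simpa using this
  have h5 : ‖θ' - θ‖ ^ 2 ≤ 4 * l ^ 2 * η ^ 2 := by
    have h6 : ‖lam M ψ θstar - lam M ψ θ‖ ≤ 2 := (norm_sub_le _ _).trans (by
      linarith [norm_lam_le M ψ θstar, norm_lam_le M ψ θ])
    have h7 : ‖θ' - θ‖ ≤ l * (η * 2) := hd.trans (by gcongr)
    calc _ ≤ (l * (η * 2)) ^ 2 := by gcongr
      _ = _ := by ring
  have h8 : ((1 - M.γ) * Lθ M.γ lψ Lψ lF LF / 2 + 3 / (2 * (α / (1 - M.γ)))) * ‖θ' - θ‖ ^ 2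
      ≤ ((1 - M.γ) * Lθ M.γ lψ Lψ lF LF / 2 + 3 / (2 * (α / (1 - M.γ)))) * (4 * l ^ 2 * η ^ 2) := by
    gcongr
  have h9 : R.gradError t ω = q - D := rfl
  rw [h9]
  change J θstar - J (R.θ (t + 1) ω) ≤ (1 - η) * (J θstar - J θ) + _ + _
  linarith

lemma Run.integral_gradError_sq_le [IsProbabilityMeasure μ] (R : Run M ψ F W p μ T N H n α)
    (hψ : PolicyRegular ψ lψ Lψ) (hF : UtilitySmooth F Λ lF LF) (hΛ : ∀ θ, lam M ψ θ ∈ Λ)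
    (hp : ∀ w ∈ W, p w ∈ stdSimplex ℝ S)
    (hΛ_est : ∀ w ∈ W, ∀ θ, withPolicy (p w) (softmax ψ θ) ∈ Λ) (hN : 1 ≤ N) {ε : ℝ} {t : ℕ}
    (ht : t < T) (hMLE : ∫ ω, ‖R.lamHat t ω - lam M ψ (R.θ t ω)‖ ^ 2 ∂μ ≤ ε) :
    Integrable (fun ω => ‖R.gradError t ω‖ ^ 2) μ ∧
      ∫ ω, ‖R.gradError t ω‖ ^ 2 ∂μ
        ≤ 4 * (lψ ^ 2 * max (lF ^ 2) (LF ^ 2)) / (1 - M.γ) ^ 2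
          * (1 / (N : ℝ) + ε + ((H : ℝ) + 1) ^ 2 * M.γ ^ (2 * H)) := by
  classical
  have hβ : 0 < 1 - M.γ := sub_pos.2 M.γ_lt_one
  have hmid : R.mid t ≤ mΩ := (R.mid_le_past t).trans (R.past_le _)
  have hest : ∀ ω, R.lamHat t ω ∈ Λ := fun ω => hΛ_est _ (R.w_mem t ht ω) _
  obtain ⟨G, hG, hFG⟩ := hF.exists_continuous_gradient
  have hG_le : ∀ θ, ‖G (lam M ψ θ)‖ ≤ lF := fun θ => by
    rw [← hFG _ (hΛ θ)]; exact hF.grad_le _ (hΛ θ)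
  have hθm : Measurable[R.mid t] (R.θ t) := (R.measurable_θ t ht.le).mono (R.past_le_mid t) le_rfl
  have hlm : Measurable[R.mid t] (R.lamHat t) := R.measurable_estimate t ht
  set Φ : (Fin N → Fin H → S × A) → Ω → ℝ := fun x ω =>
    ‖RLGU.gradError M ψ x (R.θ t ω) (gradient F (R.lamHat t ω))
      (gradient F (lam M ψ (R.θ t ω)))‖ ^ 2 with hΦ
  have hΦm : ∀ x, Measurable[R.mid t] (Φ x) := fun x => by
    -- Replacing the gradient of F by its continuous extension `G` exhibits `Φ x` as a continuous
    -- function of `mid t`-measurable quantities.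
    have h1 : Φ x = (fun z : Param d × SAVec S A =>
        ‖RLGU.gradError M ψ x z.1 z.2 (G (lam M ψ z.1))‖ ^ 2)
          ∘ fun ω => (R.θ t ω, G (R.lamHat t ω)) := by
      funext ω
      simp only [hΦ, Function.comp_apply, hFG _ (hest ω), hFG _ (hΛ (R.θ t ω))]
    rw [h1]
    exact ((continuous_gradError M hψ x (hG.comp (continuous_lam M hψ)) hG_le).norm.pow
      2).measurable.comp (hθm.prodMk (hG.measurable.comp hlm))
  have hΦ_le : ∀ x ω, |Φ x ω| ≤ (3 * lψ * lF / (1 - M.γ)) ^ 2 := fun x ω => by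
    rw [abs_of_nonneg (sq_nonneg _)]
    exact pow_le_pow_left₀ (norm_nonneg _) (norm_gradError_le M hψ hN x _
      (hF.grad_le _ (hest ω)) (hF.grad_le _ (hΛ _))) 2
  obtain ⟨hi, hi', heq⟩ := integral_eq_of_condLaw hmid
    (fun x => R.past_le _ _ (R.measurable_traj t ht x)) (R.traj_law t ht) hΦm hΦ_le
  have hlam_m : Measurable fun ω => ‖R.lamHat t ω - lam M ψ (R.θ t ω)‖ ^ 2 :=
    (((hlm.mono hmid le_rfl).sub ((continuous_lam M hψ).measurable.comp
      (R.measurable_θ' ht.le))).norm).pow_const 2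
  have hlam_i : Integrable (fun ω => ‖R.lamHat t ω - lam M ψ (R.θ t ω)‖ ^ 2) μ := by
    refine integrable_of_bounded (C := 2 ^ 2) hlam_m fun ω => ?_
    rw [abs_of_nonneg (sq_nonneg _)]
    refine pow_le_pow_left₀ (norm_nonneg _) ((norm_sub_le _ _).trans ?_) 2
    have h1 : ‖R.lamHat t ω‖ ≤ 1 :=
      norm_withPolicy_le (hp _ (R.w_mem t ht ω)) (softmax_mem ψ _)
    linarith [norm_lam_le M ψ (R.θ t ω)]
  refine ⟨hi, ?_⟩
  set K := 4 * (lψ ^ 2 * max (lF ^ 2) (LF ^ 2)) / (1 - M.γ) ^ 2 with hK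
  have hK0 : 0 ≤ K := by
    have : 0 ≤ max (lF ^ 2) (LF ^ 2) := (sq_nonneg _).trans (le_max_left _ _)
    positivity
  calc ∫ ω, ‖R.gradError t ω‖ ^ 2 ∂μ
      = ∫ ω, ∑ x, (∏ i, trajProb M (softmax ψ (R.θ t ω)) (x i)) * Φ x ω ∂μ := heq
    _ ≤ ∫ ω, K * (‖R.lamHat t ω - lam M ψ (R.θ t ω)‖ ^ 2
          + (1 / (N : ℝ) + ((H : ℝ) + 1) ^ 2 * M.γ ^ (2 * H))) ∂μ := by
        refine integral_mono hi' ((hlam_i.add (integrable_const _)).const_mul K) fun ω => ?_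
        refine (sum_gradError_sq_le M hψ H hN (R.θ t ω) (hF.grad_le _ (hest ω))
          (hF.grad_le _ (hΛ _)) (hF.grad_lipschitz _ (hest ω) _ (hΛ _))).trans (le_of_eq ?_)
        rw [← hK]
        ring
    _ = K * (∫ ω, ‖R.lamHat t ω - lam M ψ (R.θ t ω)‖ ^ 2 ∂μ
          + (1 / (N : ℝ) + ((H : ℝ) + 1) ^ 2 * M.γ ^ (2 * H))) := by
        rw [integral_const_mul, integral_add hlam_i (integrable_const _)]
        simp
    _ ≤ K * (ε + (1 / (N : ℝ) + ((H : ℝ) + 1) ^ 2 * M.γ ^ (2 * H))) := by gcongr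
    _ = _ := by ring

/-! ### Solving the recursion and matching the constants -/

lemma le_of_affine_recursion {x : ℕ → ℝ} {η K : ℝ} {T : ℕ} (hη : 0 < η) (hη_le : η ≤ 1)
    (hK : 0 ≤ K) (h : ∀ t < T, x (t + 1) ≤ (1 - η) * x t + K) :
    x T ≤ (1 - η) ^ T * x 0 + K / η := by
  induction T with
  | zero => simpa using div_nonneg hK hη.le
  | succ T ih =>
    have h1 := mul_le_mul_of_nonneg_left (ih fun t ht => h t (ht.trans T.lt_succ_self))
      (sub_nonneg.2 hη_le)
    have h2 := h T T.lt_succ_self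
    -- K / η is the fixed point of the affine map.
    have h3 : (1 - η) * (K / η) + K = K / η := by field_simp; ring
    calc x (T + 1) ≤ (1 - η) * ((1 - η) ^ T * x 0 + K / η) + K := by linarith
      _ = (1 - η) ^ (T + 1) * x 0 + ((1 - η) * (K / η) + K) := by ring
      _ = _ := by rw [h3]

lemma C₄_eq (γ lψ lF LF : ℝ) (hγ : γ < 1) :
    C₄ γ lψ lF LF = 5 * (lψ ^ 2 * max (lF ^ 2) (LF ^ 2)) / (1 - γ) ^ 4 := by
  have hβ : 0 < 1 - γ := sub_pos.2 hγ
  have h : ∀ c, 0 ≤ c → ∀ x y : ℝ, max (c * x) (c * y) = c * max x y :=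
    fun c hc x y => (mul_max_of_nonneg x y hc).symm
  have h1 : 8 * lF ^ 2 * lψ ^ 2 / (1 - γ) ^ 4 = 8 * lψ ^ 2 / (1 - γ) ^ 4 * lF ^ 2 := by ring
  have h2 : 8 * lψ ^ 2 * LF ^ 2 / (1 - γ) ^ 4 = 8 * lψ ^ 2 / (1 - γ) ^ 4 * LF ^ 2 := by ring
  rw [C₄, h1, h2, h _ (by positivity)]
  ring

/-- The recursion yields (1 - γ)(Lα/2 + 3/2) · 4l²; the coefficient of `C₃` is weaker in the 16 and
in the powers of 1 - γ. -/
lemma optimization_error_le {γ L l α η : ℝ} (hγ0 : 0 < γ) (hγ : γ < 1) (hL : 0 ≤ L) (hα : 0 < α)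
    (hη : 0 < η) :
    ((1 - γ) * L / 2 + 3 / (2 * (α / (1 - γ)))) * (4 * l ^ 2 * η ^ 2) / η
      ≤ (L * α / 2 + 16) * (4 * l ^ 2 / (1 - γ) ^ 2) * (η / α) := by
  have hβ : 0 < 1 - γ := sub_pos.2 hγ
  have hβ1 : 1 - γ ≤ 1 := by linarith
  have h2 : (1 - γ) ^ 2 ≤ 1 := pow_le_one₀ hβ.le hβ1
  calc _ = ((1 - γ) * (L * α / 2 + 3 / 2)) * (4 * l ^ 2) * (η / α) := by
        field_simp
    _ ≤ ((L * α / 2 + 16) * 1) * (4 * l ^ 2 / (1 - γ) ^ 2) * (η / α) := by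
        refine mul_le_mul_of_nonneg_right (mul_le_mul ?_ ?_ (by positivity) (by positivity))
          (by positivity)
        · have h3 : 0 ≤ L * α / 2 := by positivity
          nlinarith
        · rw [le_div_iff₀ (by positivity)]
          exact mul_le_of_le_one_right (by positivity) h2
    _ = _ := by ring

/-- The recursion yields (1 - γ)³ in the denominator; one more factor is given away to reach `C₄`.
-/
lemma estimation_error_le {γ A E α η : ℝ} (hγ0 : 0 < γ) (hγ : γ < 1) (hA : 0 ≤ A) (hE : 0 ≤ E)
    (hα : 0 < α) (hη : 0 < η) :
    5 / 4 * (α / (1 - γ)) * (4 * A / (1 - γ) ^ 2 * E) / η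
      ≤ 5 * A / (1 - γ) ^ 4 * (α / η) * E := by
  have hβ : 0 < 1 - γ := sub_pos.2 hγ
  calc _ = 5 * A / (1 - γ) ^ 3 * (α / η) * E := by field_simp
    _ ≤ _ := by
        have h1 : (1 - γ) ^ 4 ≤ (1 - γ) ^ 3 :=
          pow_le_pow_of_le_one hβ.le (by linarith) (by norm_num)
        gcongr

end Main

end RLGU

end

theorem theorem2
    {S A : Type*} [Fintype S] [Fintype A] [Nonempty S] [Nonempty A]
    (M : RLGU.MDP S A) {d : ℕ} (ψ : S → A → RLGU.Param d → ℝ) (F : RLGU.SAVec S A → ℝ)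
    (Λ : Set (RLGU.SAVec S A))
    {m : ℕ} (W : Set (Fin m → ℝ)) (p : (Fin m → ℝ) → S → ℝ)
    (hp : ∀ w ∈ W, p w ∈ stdSimplex ℝ S)
    (hΛ_occ : ∀ θ, RLGU.lam M ψ θ ∈ Λ)
    (hΛ_est : ∀ w ∈ W, ∀ θ, RLGU.withPolicy (p w) (RLGU.softmax ψ θ) ∈ Λ)
    (lψ Lψ lF LF : ℝ)
    (hψ : RLGU.PolicyRegular ψ lψ Lψ)
    (hF : RLGU.UtilitySmooth F Λ lF LF)
    (hconc : ConcaveOn ℝ Λ F)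
    (Θ : Set (RLGU.Param d)) (θstar : RLGU.Param d) (hθstar : θstar ∈ Θ)
    (hmax : IsMaxOn (fun θ => F (RLGU.lam M ψ θ)) Θ θstar)
    (l : ℝ≥0) (hl : 0 < l) (ηbar : ℝ) (hηbar : 0 < ηbar)
    (hover : RLGU.Overparametrized M ψ Λ Θ θstar l ηbar)
    {Ω : Type*} [MeasurableSpace Ω] (μ : Measure Ω) [IsProbabilityMeasure μ]
    (T N H n : ℕ) (hN : 1 ≤ N) (α : ℝ) (hα : 0 < α)
    (hαL : α ≤ 1 / (2 * RLGU.Lθ M.γ lψ Lψ lF LF))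
    (R : RLGU.Run M ψ F W p μ T N H n α)
    (hΘ : ∀ t < T, ∀ᵐ ω ∂μ, R.θ t ω ∈ Θ)
    (ε : ℝ) (hε : 0 < ε)
    (hMLE : ∀ t < T, ∫ ω, ‖R.lamHat t ω - RLGU.lam M ψ (R.θ t ω)‖ ^ 2 ∂μ ≤ ε)
    (η : ℝ) (hη : 0 < η) (hη_lt : η < ηbar) (hη_le : η ≤ 1) :
    (∀ t ≤ T, Integrable (fun ω => F (RLGU.lam M ψ θstar) - F (RLGU.lam M ψ (R.θ t ω))) μ) ∧
    (Θ = Set.univ →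
      ∫ ω, (F (RLGU.lam M ψ θstar) - F (RLGU.lam M ψ (R.θ T ω))) ∂μ
        ≤ (1 - η) ^ T * ∫ ω, (F (RLGU.lam M ψ θstar) - F (RLGU.lam M ψ (R.θ 0 ω))) ∂μ
          + RLGU.C₃ M.γ lψ Lψ lF LF l α * (η / α)
          + RLGU.C₄ M.γ lψ lF LF * (α / η) * (1 / (N : ℝ) + ε)) ∧
    (∫ ω, (F (RLGU.lam M ψ θstar) - F (RLGU.lam M ψ (R.θ T ω))) ∂μ
        ≤ (1 - η) ^ T * ∫ ω, (F (RLGU.lam M ψ θstar) - F (RLGU.lam M ψ (R.θ 0 ω))) ∂μ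
          + RLGU.C₃ M.γ lψ Lψ lF LF l α * (η / α)
          + RLGU.C₄ M.γ lψ lF LF * (α / η)
            * (1 / (N : ℝ) + ε + ((H : ℝ) + 1) ^ 2 * M.γ ^ (2 * H))) := by
  have hη0 : 0 ≤ 1 - η := sub_nonneg.2 hη_le
  have hLθ := RLGU.Lθ_pos M hψ hF.lF_pos hF.LF_pos
  have hβ : 0 < 1 - M.γ := sub_pos.2 M.γ_lt_one
  have hgap := fun t (ht : t ≤ T) => R.integrable_gap hψ hF hconc.1 hΛ_occ θstar ht
  have hB : 0 ≤ lψ ^ 2 * max (lF ^ 2) (LF ^ 2) :=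
    mul_nonneg (sq_nonneg _) ((sq_nonneg _).trans (le_max_left _ _))
  have hγH : 0 ≤ M.γ ^ (2 * H) := pow_nonneg M.γ_pos.le _
  refine ⟨hgap, fun hΘ_univ => ?_, ?_⟩
  · subst hΘ_univ
    -- λ is constant, so the gap vanishes at every time and only the nonnegative error terms remain.
    have h0 : ∀ t, ∫ ω, (F (RLGU.lam M ψ θstar) - F (RLGU.lam M ψ (R.θ t ω))) ∂μ = 0 := fun t => by
      simp [hover.lam_eq hψ hl hηbar]
    rw [h0, h0, mul_zero, zero_add, RLGU.C₄_eq _ _ _ _ M.γ_lt_one, RLGU.C₃]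
    positivity
  · set E : ℝ := 1 / (N : ℝ) + ε + ((H : ℝ) + 1) ^ 2 * M.γ ^ (2 * H)
    have hE : 0 ≤ E := by positivity
    set K₁ := ((1 - M.γ) * RLGU.Lθ M.γ lψ Lψ lF LF / 2 + 3 / (2 * (α / (1 - M.γ))))
      * (4 * (l : ℝ) ^ 2 * η ^ 2)
    set K₂ := 5 / 4 * (α / (1 - M.γ))
      * (4 * (lψ ^ 2 * max (lF ^ 2) (LF ^ 2)) / (1 - M.γ) ^ 2 * E)
    have hrec : ∀ t < T,
        ∫ ω, (F (RLGU.lam M ψ θstar) - F (RLGU.lam M ψ (R.θ (t + 1) ω))) ∂μ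
          ≤ (1 - η) * ∫ ω, (F (RLGU.lam M ψ θstar) - F (RLGU.lam M ψ (R.θ t ω))) ∂μ
            + (K₁ + K₂) := by
      intro t ht
      obtain ⟨hi, he⟩ := R.integral_gradError_sq_le hψ hF hΛ_occ hp hΛ_est hN ht (hMLE t ht)
      have hi₁ := (hgap t ht.le).const_mul (1 - η)
      have hi₂ := hi.const_mul (5 / 4 * (α / (1 - M.γ)))
      have hi₃ : Integrable (fun ω => (1 - η) * (F (RLGU.lam M ψ θstar)
        - F (RLGU.lam M ψ (R.θ t ω))) + K₁) μ := hi₁.add (integrable_const K₁)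
      have h1 : ∫ ω, (F (RLGU.lam M ψ θstar) - F (RLGU.lam M ψ (R.θ (t + 1) ω))) ∂μ
          ≤ ∫ ω, ((1 - η) * (F (RLGU.lam M ψ θstar) - F (RLGU.lam M ψ (R.θ t ω))) + K₁
            + 5 / 4 * (α / (1 - M.γ)) * ‖R.gradError t ω‖ ^ 2) ∂μ := by
        -- The one-step inequality needs θ_t ∈ Θ, hence holds only almost surely; θ_{t+1} may leave
        -- Θ, which allows t + 1 = T.
        refine integral_mono_ae (hgap (t + 1) ht) (hi₃.add hi₂) ?_
        filter_upwards [hΘ t ht] with ω hω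
        exact R.gap_succ_le hψ hF hconc hΛ_occ hover hα hαL hη hη_lt hη_le ht hω
      rw [integral_add hi₃ hi₂,
        integral_add hi₁ (integrable_const K₁), integral_const, integral_const_mul,
        integral_const_mul, probReal_univ, one_smul] at h1
      have h2 : 5 / 4 * (α / (1 - M.γ)) * ∫ ω, ‖R.gradError t ω‖ ^ 2 ∂μ ≤ K₂ :=
        mul_le_mul_of_nonneg_left he (by positivity)
      linarith
    have hK₁0 : 0 ≤ K₁ := by positivity
    have hK₂0 : 0 ≤ K₂ := by positivity
    have hmain := RLGU.le_of_affine_recursion (T := T)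
      (x := fun t => ∫ ω, (F (RLGU.lam M ψ θstar) - F (RLGU.lam M ψ (R.θ t ω))) ∂μ)
      hη hη_le (add_nonneg hK₁0 hK₂0) hrec
    have h3 := RLGU.optimization_error_le (l := (l : ℝ)) M.γ_pos M.γ_lt_one hLθ.le hα hη
    have h4 := RLGU.estimation_error_le M.γ_pos M.γ_lt_one hB hE hα hη
    rw [add_div] at hmain
    rw [RLGU.C₄_eq _ _ _ _ M.γ_lt_one, RLGU.C₃]
    linarith
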